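/- Let $T=\begin{pmatrix}1&1\\0&1\end{pmatrix}$ and, for integers $a_1,\dots,a_n$, let $$M_n(a_1,\dots,a_n)=\begin{pmatrix}a_n&-1\\1&0\end{pmatrix}\begin{pmatrix}a_{n-1}&-1\\1&0\end{pmatrix}\cdots\begin{pmatrix}a_1&-1\\1&0\end{pmatrix}.$$ A solution of $(E_T)$ is a tuple $(a_1,\dots,a_n)$ of positive integers with $M_n(a_1,\dots,a_n)=\pm T$. Below, a decomposition of a convex polygon $P$ is a decomposition of $P$ into sub-polygons by a (possibly empty) set of diagonals that meet only at vertices of $P$. A *notched 3d-dissection* (3d-dissection échancrée) of a convex polygon $P$ with $m+1$ vertices is a decomposition of $P$ such that exactly one sub-polygon is a quadrilateral, all other sub-polygons have a number of vertices divisible by $3$, and exactly two sides of the quadrilateral are sides of $P$, these two sides having a common vertex. Number this common vertex $0$ and the other vertices $1,\dots,m$ counterclockwise. The *quiddity* of the dissection is $(a_1,\dots,a_m)$, where $a_i$ is the number of sub-polygons that contain the vertex $i$ and have a number of vertices divisible by $3$. A *capped 3d-dissection* (3d-dissection coiffée) of a convex polygon $P$ with $n+2$ vertices ($n\ge 3$)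 is a decomposition of $P$ in which every sub-polygon has a number of vertices divisible by $3$, together with a triangle $U$ of the decomposition having exactly two sides that are sides of $P$, such that $U$ has a side in common with another triangle $V$ of the decomposition, and a side of $V$ is a side of $P$. The triangle $U$ has weight $-1$, and all other sub-polygons (in particular $V$) have weight $1$. Number $0$ the vertex that belongs to $U$ only, $-1$ the vertex that belongs to $U$ and $V$ only, and the other vertices so that $-1,0,1,\dots,n$ is the cyclic order of the vertices along the boundary of $P$ (in one of its two directions), $n$ being adjacent to $-1$. The *quiddity* of the dissection is $(a_1,\dots,a_n)$, where $a_i$ is the sum of the weights of the sub-polygons that contain the vertex $i$. **Theorem.** Let $n\ge 3$. (i) For integers $a_1,\dots,a_{n-1}$, the tuple $(a_1,\dots,a_{n-1},1)$ is a solution of $(E_T)$ if and only if $(a_1,\dots,a_{n-1})$ is the quiddity of a notched 3d-dissection of a convex polygon with $n$ vertices. (ii) For integers $a_1,\dots,a_n$, the tuple $(a_1,\dots,a_n)$ is a solution of $(E_T)$ with $a_n\ge 2$ if and only if it is the quiddity of a capped 3d-dissection of a convex polygon with $n+2$ vertices. -/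

import Mathlib

/-- The matrix `M_n(a₁, …, aₙ) = A(aₙ) A(aₙ₋₁) ⋯ A(a₁)`, where `A(c) = [[c, -1], [1, 0]]`.
The entry `a_i` of the tuple is `a (i - 1)`. -/
def modularProd {n : ℕ} (a : Fin n → ℤ) : Matrix (Fin 2) (Fin 2) ℤ :=
  ((List.ofFn fun i => (!![a i, -1; 1, 0] : Matrix (Fin 2) (Fin 2) ℤ)).reverse).prod

/-- The matrix `T = [[1, 1], [0, 1]]`. -/
def matT : Matrix (Fin 2) (Fin 2) ℤ := !![1, 1; 0, 1]

/-- `(a₁, …, aₙ)` is a tuple of positive integers with `M_n(a₁, …, aₙ) = ± T`. -/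
def IsSolutionT {n : ℕ} (a : Fin n → ℤ) : Prop :=
  (∀ i, 0 < a i) ∧ (modularProd a = matT ∨ modularProd a = -matT)

/-! ### Polygons and dissections

The vertices of a convex polygon `P` with `N` vertices are `0, 1, …, N - 1`, in cyclic order along
the boundary. A convex polygon whose vertices are among those of `P` is given by its set of
vertices `S` (with at least three elements), `P` itself being `Finset.univ`. A segment joining two
distinct vertices is a pair `(i, j)` with `i < j`. -/

/-- The segment `p` is a side of the convex polygon with vertex set `S`: its two ends are
consecutive elements of `S` in the cyclic order, i.e. all of `S` lies on one side of `p`. -/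
def IsSide {N : ℕ} (S : Finset (Fin N)) (p : Fin N × Fin N) : Prop :=
  p.1 ∈ S ∧ p.2 ∈ S ∧ p.1 < p.2 ∧
    ((∀ k ∈ S, k ≤ p.1 ∨ p.2 ≤ k) ∨ (∀ k ∈ S, p.1 ≤ k ∧ k ≤ p.2))

instance {N : ℕ} (S : Finset (Fin N)) (p : Fin N × Fin N) : Decidable (IsSide S p) := by
  unfold IsSide; infer_instance

/-- The segment `p` is a diagonal of the convex polygon with vertex set `S`. -/
def IsDiagonal {N : ℕ} (S : Finset (Fin N)) (p : Fin N × Fin N) : Prop :=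
  p.1 ∈ S ∧ p.2 ∈ S ∧ p.1 < p.2 ∧ ¬ IsSide S p

instance {N : ℕ} (S : Finset (Fin N)) (p : Fin N × Fin N) : Decidable (IsDiagonal S p) := by
  unfold IsDiagonal; infer_instance

/-- Two segments joining vertices of a convex polygon cross at a point other than a vertex: their
ends alternate along the boundary. -/
def Crosses {N : ℕ} (p q : Fin N × Fin N) : Prop :=
  (p.1 < q.1 ∧ q.1 < p.2 ∧ p.2 < q.2) ∨ (q.1 < p.1 ∧ p.1 < q.2 ∧ q.2 < p.2)

instance {N : ℕ} (p q : Fin N × Fin N) : Decidable (Crosses p q) := by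
  unfold Crosses; infer_instance

/-- A decomposition of a convex polygon with `N` vertices into sub-polygons, by a (possibly empty)
set of diagonals that meet only at vertices. -/
structure PolygonDissection (N : ℕ) where
  diagonals : Finset (Fin N × Fin N)
  isDiagonal : ∀ p ∈ diagonals, IsDiagonal Finset.univ p
  noncrossing : ∀ p ∈ diagonals, ∀ q ∈ diagonals, ¬ Crosses p q

namespace PolygonDissection

/-- `S` is the vertex set of one of the sub-polygons of the decomposition: a polygon bounded by
sides of `P` and diagonals of the decomposition, and cut by no diagonal of the decomposition. -/
def IsSubpolygon {N : ℕ} (D : PolygonDissection N) (S : Finset (Fin N)) : Prop :=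
  3 ≤ S.card ∧ (∀ p, IsSide S p → IsSide Finset.univ p ∨ p ∈ D.diagonals) ∧
    ∀ p ∈ D.diagonals, ¬ IsDiagonal S p

instance {N : ℕ} (D : PolygonDissection N) (S : Finset (Fin N)) : Decidable (D.IsSubpolygon S) := by
  unfold IsSubpolygon; infer_instance

/-- The sub-polygons of the decomposition. -/
def subpolygons {N : ℕ} (D : PolygonDissection N) : Finset (Finset (Fin N)) :=
  Finset.univ.filter D.IsSubpolygon

end PolygonDissection

/-- The sides of the polygon with vertex set `S` that are also sides of `P`. -/
def outerSides {N : ℕ} (S : Finset (Fin N)) : Finset (Fin N × Fin N) :=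
  Finset.univ.filter fun p => IsSide S p ∧ IsSide Finset.univ p

/-- `D` is a notched 3d-dissection ("3d-dissection échancrée") of a convex polygon with `m + 1`
vertices, numbered in cyclic order from the vertex `0` of the notch: exactly one sub-polygon `Q`
is a quadrilateral, all others have a number of vertices divisible by 3, and exactly two sides of
`Q` are sides of `P`, these two sides having the vertex `0` in common. -/
def PolygonDissection.IsNotched {m : ℕ} (D : PolygonDissection (m + 1)) : Prop :=
  ∃ Q ∈ D.subpolygons, Q.card = 4 ∧ (∀ S ∈ D.subpolygons, S ≠ Q → 3 ∣ S.card) ∧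
    (outerSides Q).card = 2 ∧ ∀ p ∈ outerSides Q, p.1 = 0 ∨ p.2 = 0

/-- `(a₁, …, a_m)` is the quiddity of a notched 3d-dissection of a convex polygon with `m + 1`
vertices: `a_i` is the number of sub-polygons that have a number of vertices divisible by 3 and
contain the vertex `i`. -/
def IsNotchedQuiddity {m : ℕ} (a : Fin m → ℤ) : Prop :=
  ∃ D : PolygonDissection (m + 1), D.IsNotched ∧
    ∀ i : Fin m, a i = ((D.subpolygons.filter fun S => 3 ∣ S.card ∧ i.succ ∈ S).card : ℤ)

/-- `D` is a capped 3d-dissection ("3d-dissection coiffée") of a convex polygon with `n + 2`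
vertices, with the triangle `U` of weight `-1` and the neighbouring triangle `V` of weight `1`.
The vertices are numbered `-1, 0, 1, …, n` in cyclic order, `-1` being the last vertex of
`Fin (n + 2)`; `0` is the vertex that belongs to `U` only, and `-1` is the vertex that belongs
to `U` and `V` only. -/
def PolygonDissection.IsCapped {n : ℕ} (D : PolygonDissection (n + 2))
    (U V : Finset (Fin (n + 2))) : Prop :=
  (∀ S ∈ D.subpolygons, 3 ∣ S.card) ∧
    (U ∈ D.subpolygons ∧ U.card = 3 ∧ (outerSides U).card = 2) ∧
    (V ∈ D.subpolygons ∧ V ≠ U ∧ V.card = 3 ∧ (∃ p, IsSide U p ∧ IsSide V p) ∧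
      (outerSides V).Nonempty) ∧
    (∀ S ∈ D.subpolygons, 0 ∈ S ↔ S = U) ∧
    (∀ S ∈ D.subpolygons, Fin.last (n + 1) ∈ S ↔ S = U ∨ S = V)

/-- `(a₁, …, aₙ)` is the quiddity of a capped 3d-dissection of a convex polygon with `n + 2`
vertices: `a_i` is the sum of the weights of the sub-polygons that contain the vertex `i`, where
the triangle `U` has weight `-1` and all other sub-polygons have weight `1`. -/
def IsCappedQuiddity {n : ℕ} (a : Fin n → ℤ) : Prop :=
  ∃ (D : PolygonDissection (n + 2)) (U V : Finset (Fin (n + 2))), D.IsCapped U V ∧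
    ∀ i : Fin n, a i =
      ∑ S ∈ D.subpolygons.filter fun S => i.succ.castSucc ∈ S, if S = U then (-1 : ℤ) else 1

/-! Write A(c) for `stepMatrix c`. Since T·A(c) = A(c + 1) (`matT_mul_stepMatrix`), a product equals
±T exactly when lowering the last entry by 1 gives a product ±1. The problem thus becomes M = ±1 for
tuples whose entries are positive, except that the last one may be 0.

When all entries are positive, the solutions of M = ±1 are the quiddities of 3d-dissections, and
`EarList` is the bridge. On the matrix side (`earList_iff`), gluing an ear with 3k + 3 vertices
preserves M up to sign because A(1)³ = -1 and A(y + 1)A(1)A(x + 1) = A(y)A(x). Conversely, a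
positive tuple that is not all ones and contains no ear reduces to a nonempty list of entries ≥ 2,
whose product has too large a corner entry to be a power of A(1) up to sign. On the geometric side
(`IsThreeD.earList`, `exists_of_earList`), a shortest diagonal cuts off an ear, and ears can be
glued back.

If the last entry of the original tuple is at least 2, the lowered tuple is positive. In a capped
dissection the triangles U and V are forced to be {-1, 0, 1} and {1, n, -1}. Their weights cancel at
vertex 1 and leave +1 at vertex n, so removing them gives an ordinary 3d-dissection of the polygon
1, …, n (`isCappedQuiddity_iff`).

If the last entry is 1, the lowered entry is 0. Read cyclically, A(u)A(0)A(v) = -A(u + v) merges its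
neighbours v and u into one vertex of a 3d-dissection. As u and v are positive, a diagonal from that
vertex separates u of its sub-polygons from the other v (`EarList.isSplit`). Cutting there gives two
3d-dissections that share only the far end of the diagonal. These are the two pieces attached to the
quadrilateral {0, 1, c, m} of a notched dissection (`isSplit_iff`, `isNotchedQuiddity_iff`). -/

/-! ### Matrix products up to sign and local relations. -/

/-- The matrix `[[c, -1], [1, 0]]`. -/
def stepMatrix (c : ℤ) : Matrix (Fin 2) (Fin 2) ℤ := !![c, -1; 1, 0]

/-- The product of the matrices `stepMatrix c` over a list, the first entry acting first. -/
def listProd (L : List ℤ) : Matrix (Fin 2) (Fin 2) ℤ := ((L.map stepMatrix).reverse).prod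

/-- Equality of matrices up to sign. -/
def EqUpToSign (X Y : Matrix (Fin 2) (Fin 2) ℤ) : Prop := X = Y ∨ X = -Y

namespace EqUpToSign

variable {X Y Z W : Matrix (Fin 2) (Fin 2) ℤ}

theorem refl (X : Matrix (Fin 2) (Fin 2) ℤ) : EqUpToSign X X := Or.inl rfl

theorem symm (h : EqUpToSign X Y) : EqUpToSign Y X := by
  rcases h with rfl | rfl
  · exact Or.inl rfl
  · exact Or.inr (neg_neg _).symm

theorem trans (h : EqUpToSign X Y) (h' : EqUpToSign Y Z) : EqUpToSign X Z := by
  rcases h with rfl | rfl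
  · exact h'
  · rcases h' with rfl | rfl
    · exact Or.inr rfl
    · exact Or.inl (neg_neg _)

theorem mul (h : EqUpToSign X Y) (h' : EqUpToSign Z W) : EqUpToSign (X * Z) (Y * W) := by
  rcases h with rfl | rfl <;> rcases h' with rfl | rfl <;> simp [EqUpToSign]

theorem mul_right (h : EqUpToSign X Y) (Z : Matrix (Fin 2) (Fin 2) ℤ) :
    EqUpToSign (X * Z) (Y * Z) := h.mul (refl Z)

theorem mul_left (h : EqUpToSign X Y) (Z : Matrix (Fin 2) (Fin 2) ℤ) :
    EqUpToSign (Z * X) (Z * Y) := (refl Z).mul h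

theorem pow_one (h : EqUpToSign X 1) (k : ℕ) : EqUpToSign (X ^ k) 1 := by
  induction k with
  | zero => exact Or.inl rfl
  | succ k ih => simpa [pow_succ] using ih.mul h

theorem one_comm (h : EqUpToSign (X * Y) 1) : EqUpToSign (Y * X) 1 := by
  rcases h with h | h
  · exact Or.inl (mul_eq_one_comm.mp h)
  · refine Or.inr ?_
    have h1 : (-X) * Y = 1 := by rw [neg_mul, h, neg_neg]
    have h2 := mul_eq_one_comm.mp h1
    rw [mul_neg] at h2
    rw [← h2, neg_neg]

end EqUpToSign

theorem listProd_nil : listProd [] = 1 := rfl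

theorem listProd_append (l r : List ℤ) : listProd (l ++ r) = listProd r * listProd l := by
  simp [listProd]

theorem listProd_cons (a : ℤ) (L : List ℤ) : listProd (a :: L) = listProd L * stepMatrix a := by
  simp [listProd]

theorem listProd_singleton (a : ℤ) : listProd [a] = stepMatrix a := by
  simp [listProd]

theorem listProd_replicate (k : ℕ) (c : ℤ) :
    listProd (List.replicate k c) = stepMatrix c ^ k := by
  simp [listProd]

theorem stepMatrix_one_pow_three : EqUpToSign (stepMatrix 1 ^ 3) 1 := by
  right; simp only [stepMatrix]; decide

theorem stepMatrix_one_pow_mul_three (k : ℕ) : EqUpToSign (stepMatrix 1 ^ (3 * k)) 1 := by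
  rw [pow_mul]; exact stepMatrix_one_pow_three.pow_one k

theorem stepMatrix_one_pow_mod (k : ℕ) :
    EqUpToSign (stepMatrix 1 ^ k) (stepMatrix 1 ^ (k % 3)) := by
  conv_lhs => rw [← Nat.div_add_mod k 3, pow_add]
  simpa using (stepMatrix_one_pow_mul_three (k / 3)).mul_right (stepMatrix 1 ^ (k % 3))

/-- The effect of cutting off a triangle with free vertex 1: both neighbours lose one sub-polygon.
-/
theorem stepMatrix_mul_one_mul (x y : ℤ) :
    stepMatrix (y + 1) * stepMatrix 1 * stepMatrix (x + 1) = stepMatrix y * stepMatrix x := by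
  ext i j; fin_cases i <;> fin_cases j <;> simp [stepMatrix, Matrix.mul_apply] <;> ring

theorem stepMatrix_mul_one_sq_mul (x y : ℤ) :
    stepMatrix y * stepMatrix 1 ^ 2 * stepMatrix x = -stepMatrix (x + y - 1) := by
  ext i j; fin_cases i <;> fin_cases j <;> simp [stepMatrix, Matrix.mul_apply, pow_two] <;> ring

/-- A zero entry fuses its two neighbours. Read from right to left, the relation splits a vertex in
two, which is how the notch arises. -/
theorem stepMatrix_mul_zero_mul (x y : ℤ) :
    stepMatrix y * stepMatrix 0 * stepMatrix x = -stepMatrix (x + y) := by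
  ext i j; fin_cases i <;> fin_cases j <;> simp [stepMatrix, Matrix.mul_apply] <;> ring

theorem matT_mul_stepMatrix (x : ℤ) : matT * stepMatrix x = stepMatrix (x + 1) := by
  ext i j; fin_cases i <;> fin_cases j <;> simp [stepMatrix, matT, Matrix.mul_apply, add_comm]

/-! ### Positive tuples with product ±1. -/

/-- The lists obtained from a list of `3 * k + 3` ones by repeatedly glueing a polygon with
`3 * k + 3` vertices on the segment between two consecutive entries. -/
inductive EarList : List ℤ → Prop
  | base (k : ℕ) : EarList (List.replicate (3 * k + 3) 1)
  | ear (l r : List ℤ) (x y : ℤ) (k : ℕ) (h : EarList (l ++ x :: y :: r)) :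
      EarList (l ++ (x + 1) :: (List.replicate (3 * k + 1) 1 ++ (y + 1) :: r))

/-- Modulo sign the 3k extra ones vanish, since `stepMatrix 1` has cube -1. What remains is the
triangle case. -/
theorem listProd_ear (l r : List ℤ) (x y : ℤ) (k : ℕ) :
    EqUpToSign (listProd (l ++ (x + 1) :: (List.replicate (3 * k + 1) 1 ++ (y + 1) :: r)))
      (listProd (l ++ x :: y :: r)) := by
  simp only [listProd_append, listProd_cons, listProd_replicate]
  refine EqUpToSign.mul_right ?_ _
  have h := (stepMatrix_one_pow_mul_three k).mul (EqUpToSign.refl (stepMatrix 1))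
  rw [one_mul, ← pow_succ] at h
  have h2 := (h.mul_left (listProd r * stepMatrix (y + 1))).mul_right (stepMatrix (x + 1))
  refine h2.trans ?_
  have h3 := stepMatrix_mul_one_mul x y
  left
  simp only [mul_assoc] at h3 ⊢
  rw [h3]

theorem EarList.listProd {L : List ℤ} (h : EarList L) : EqUpToSign (listProd L) 1 := by
  induction h with
  | base k =>
    rw [listProd_replicate]
    exact stepMatrix_one_pow_mul_three (k + 1)
  | ear l r x y k h ih => exact (listProd_ear l r x y k).trans ih

theorem EarList.pos {L : List ℤ} (h : EarList L) : ∀ x ∈ L, 0 < x := by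
  induction h with
  | base k =>
    intro x hx
    rw [List.eq_of_mem_replicate hx]; exact one_pos
  | ear l r x y k h ih =>
    intro z hz
    have hx := ih x (by simp)
    have hy := ih y (by simp)
    simp only [List.mem_append, List.mem_cons, List.mem_replicate] at hz
    rcases hz with hz | rfl | ⟨-, rfl⟩ | rfl | hz
    · exact ih z (by simp [hz])
    · omega
    · omega
    · omega
    · exact ih z (by simp [hz])

/-- A list of positive integers in which no block of `3 * k + 1` ones is enclosed by two larger
entries is, up to powers of `stepMatrix 1` at both ends, equivalent to a list of integers `≥ 2`. -/
theorem exists_ear_or_reduced (L : List ℤ) (hL : ∀ x ∈ L, 0 < x) :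
    (∃ (l r : List ℤ) (x y : ℤ) (k : ℕ), 0 < x ∧ 0 < y ∧
      L = l ++ (x + 1) :: (List.replicate (3 * k + 1) 1 ++ (y + 1) :: r)) ∨
    L = List.replicate L.length 1 ∨
    ∃ (i j : ℕ) (a c : ℤ) (R C : List ℤ), L = List.replicate i 1 ++ a :: R ∧ 2 ≤ a ∧
      (∀ x ∈ c :: C, 2 ≤ x) ∧
      EqUpToSign (listProd L) (stepMatrix 1 ^ j * listProd (c :: C) * stepMatrix 1 ^ i) := by
  induction L with
  | nil => right; left; rfl
  | cons b L ih =>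
    have hb := hL b (by simp)
    rcases ih fun x hx => hL x (by simp [hx]) with
      ⟨l, r, x, y, k, hx, hy, rfl⟩ | h | ⟨i, j, a, c, R, C, h, ha, hC, hM⟩
    · exact Or.inl ⟨b :: l, r, x, y, k, hx, hy, rfl⟩
    · right
      rcases (show b = 1 ∨ 2 ≤ b by omega) with rfl | hb2
      · left
        rw [List.length_cons, List.replicate_succ, ← h]
      · right
        -- The tail consists of ones only, so it becomes the left power of `stepMatrix 1` and `b` is
        -- the whole reduced list.
        refine ⟨0, L.length, b, b, L, [], rfl, hb2, by simpa using hb2, ?_⟩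
        left
        conv_lhs => rw [h]
        simp [listProd_cons, listProd_replicate, listProd_nil]
    · rcases (show b = 1 ∨ 2 ≤ b by omega) with rfl | hb2
      · right; right
        refine ⟨i + 1, j, a, c, R, C, by rw [h, List.replicate_succ, List.cons_append], ha, hC, ?_⟩
        rw [listProd_cons, pow_succ, ← mul_assoc]
        exact hM.mul_right _
      · have hi : i % 3 < 3 := Nat.mod_lt _ (by norm_num)
        have hM' := (hM.trans ((stepMatrix_one_pow_mod i).mul_left _)).mul_right (stepMatrix b)
        rw [← listProd_cons] at hM'
        -- A block of `i` ones separates `b` from the next larger entry `a`. Modulo 3, length 0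
        -- means the block disappears, length 1 means an ear, and length 2 means that `b` merges
        -- with the next reduced entry `c` into `b + c - 1`. Both `a` and `c` are tracked because
        -- mergers can make the reduced entry differ from the actual one.
        interval_cases hi3 : i % 3
        · right; right
          refine ⟨0, j, b, b, L, c :: C, rfl, hb2, ?_, ?_⟩
          · intro x hx
            rcases List.mem_cons.mp hx with rfl | hx
            · exact hb2
            · exact hC x hx
          · refine hM'.trans ?_
            left
            simp [listProd_cons, mul_assoc]
        · left
          refine ⟨[], R, b - 1, a - 1, i / 3, by omega, by omega, ?_⟩
          rw [h, sub_add_cancel, sub_add_cancel, show 3 * (i / 3) + 1 = i by omega]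
          rfl
        · right; right
          have hc := hC c (by simp)
          refine ⟨0, j, b, b + c - 1, L, C, rfl, hb2, ?_, ?_⟩
          · intro x hx
            rcases List.mem_cons.mp hx with rfl | hx
            · omega
            · exact hC x (by simp [hx])
          · refine hM'.trans ?_
            right
            have := stepMatrix_mul_one_sq_mul b c
            rw [listProd_cons, listProd_cons, pow_zero, mul_one]
            rw [show stepMatrix 1 ^ j * (listProd C * stepMatrix c) * stepMatrix 1 ^ 2 *
              stepMatrix b = stepMatrix 1 ^ j * (listProd C *
                (stepMatrix c * stepMatrix 1 ^ 2 * stepMatrix b)) by simp only [mul_assoc], this]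
            simp

/-- If the first row is (p, -q) with 0 ≤ q < p, multiplying by `stepMatrix c` gives (pc - q, -p). As
c ≥ 2, pc - q ≥ p + (p - q) > p, so the corner entry grows at every step. -/
theorem listProd_two_le (C : List ℤ) (hC : ∀ x ∈ C, 2 ≤ x) :
    0 ≤ -listProd C 0 1 ∧ -listProd C 0 1 < listProd C 0 0 ∧
      (C.length : ℤ) + 1 ≤ listProd C 0 0 := by
  induction C with
  | nil => simp [listProd_nil]
  | cons c C ih =>
    obtain ⟨h1, h2, h3⟩ := ih fun x hx => hC x (by simp [hx])
    have hc := hC c (by simp)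
    rw [listProd_cons]
    have e0 : (listProd C * stepMatrix c) 0 0 = listProd C 0 0 * c + listProd C 0 1 := by
      simp [Matrix.mul_apply, stepMatrix]
    have e1 : (listProd C * stepMatrix c) 0 1 = -listProd C 0 0 := by
      simp [Matrix.mul_apply, stepMatrix]
    have h4 : listProd C 0 0 * 2 ≤ listProd C 0 0 * c :=
      mul_le_mul_of_nonneg_left hc (by linarith)
    rw [e0, e1, List.length_cons]
    push_cast
    refine ⟨by linarith, by linarith, by linarith⟩

theorem stepMatrix_one_pow_entry_le (k : ℕ) : (stepMatrix 1 ^ k) 0 0 ≤ 1 ∧ -1 ≤ (stepMatrix 1 ^ k) 0 0 := by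
  have key : ∀ r < 3, (stepMatrix 1 ^ r) 0 0 ≤ 1 ∧ -1 ≤ (stepMatrix 1 ^ r) 0 0 := by
    unfold stepMatrix; decide
  have h := key (k % 3) (Nat.mod_lt _ (by norm_num))
  rcases stepMatrix_one_pow_mod k with h' | h' <;> rw [h']
  · exact h
  · rw [Matrix.neg_apply]; constructor <;> linarith [h.1, h.2]

/-- Strong induction on the length: an ear can be removed, a list of ones must have length divisible
by 3, and a reduced list is excluded by the growth of the corner entry. -/
theorem EarList.of_listProd {L : List ℤ} (h0 : L ≠ []) (hpos : ∀ x ∈ L, 0 < x)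
    (hM : EqUpToSign (_root_.listProd L) 1) : EarList L := by
  induction hn : L.length using Nat.strong_induction_on generalizing L with
  | _ n ih =>
    subst hn
    rcases exists_ear_or_reduced L hpos with
      ⟨l, r, x, y, k, hx, hy, rfl⟩ | h | ⟨i, j, a, c, R, C, -, -, hC, hM'⟩
    · refine EarList.ear l r x y k (ih _ ?_ (by simp) ?_
        ((listProd_ear l r x y k).symm.trans hM) rfl)
      · simp
      · intro z hz
        simp only [List.mem_append, List.mem_cons] at hz
        rcases hz with hz | rfl | rfl | hz
        · exact hpos z (by simp [hz])
        · exact hx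
        · exact hy
        · exact hpos z (by simp [hz])
    · have hlen : L.length ≠ 0 := by simpa using h0
      rw [h, listProd_replicate] at hM
      have h3 := (stepMatrix_one_pow_mod L.length).symm.trans hM
      have hm : L.length % 3 = 0 := by
        have key : ∀ r < 3, (stepMatrix 1 ^ r = 1 ∨ stepMatrix 1 ^ r = -1) → r = 0 := by
          unfold stepMatrix; decide
        exact key _ (Nat.mod_lt _ (by norm_num)) h3
      rw [h, show L.length = 3 * (L.length / 3 - 1) + 3 by omega]
      exact EarList.base _
    · exfalso
      have h1 := hM'.symm.trans hM
      rw [mul_assoc] at h1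
      have h2 := h1.one_comm
      rw [mul_assoc, ← pow_add] at h2
      -- The exponent `2 * (i + j)` completes `i + j` to a multiple of 3, so this power inverts
      -- `stepMatrix 1 ^ (i + j)` up to sign.
      have h3 := (h2.mul_right (stepMatrix 1 ^ (2 * (i + j))))
      rw [one_mul, mul_assoc, ← pow_add, show i + j + 2 * (i + j) = 3 * (i + j) by ring] at h3
      have h4 := ((stepMatrix_one_pow_mul_three (i + j)).symm.mul_left (_root_.listProd (c :: C))).trans h3
      rw [mul_one] at h4
      have h5 := stepMatrix_one_pow_entry_le (2 * (i + j))
      have h6 := (listProd_two_le _ hC).2.2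
      rw [List.length_cons] at h6
      push_cast at h6
      rcases h4 with h4 | h4 <;> rw [h4] at h6
      · linarith [h5.1]
      · rw [Matrix.neg_apply] at h6; linarith [h5.2]

theorem earList_iff {L : List ℤ} :
    EarList L ↔ L ≠ [] ∧ (∀ x ∈ L, 0 < x) ∧ EqUpToSign (listProd L) 1 := by
  refine ⟨fun h => ⟨?_, h.pos, h.listProd⟩, fun h => EarList.of_listProd h.1 h.2.1 h.2.2⟩
  cases h <;> simp

/-- Ears are never glued across the ends of a list, so cyclic invariance is not visible in the
inductive definition. It comes from the matrix criterion, which is invariant under conjugation. -/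
theorem EarList.rotate {a : ℤ} {L : List ℤ} (h : EarList (a :: L)) : EarList (L ++ [a]) := by
  rw [earList_iff] at h ⊢
  refine ⟨by simp, fun x hx => h.2.1 x ?_, ?_⟩
  · simp only [List.mem_append, List.mem_singleton] at hx
    simp only [List.mem_cons]; tauto
  · rw [listProd_append, listProd_singleton]
    have := h.2.2
    rw [listProd_cons] at this
    exact this.one_comm

/-! ### Cutting a tuple into two pieces. -/

/-- A splitting of a list as a gluing of two `EarList`s at a common entry. -/
def IsSplit (L : List ℤ) : Prop :=
  ∃ (l r : List ℤ) (x y : ℤ), EarList (l ++ [x]) ∧ EarList (y :: r) ∧ L = l ++ (x + y) :: r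

/-- Adjacent entries always belong to a common piece, so the ear can be glued inside that piece. The
cases are the position of the splitting entry: before `x`, at `x`, at `y`, or after `y`. -/
theorem IsSplit.ear {l r : List ℤ} {x y : ℤ} (h : IsSplit (l ++ x :: y :: r)) (k : ℕ) :
    IsSplit (l ++ (x + 1) :: (List.replicate (3 * k + 1) 1 ++ (y + 1) :: r)) := by
  obtain ⟨l', r', s, t, hl, hr, h⟩ := h
  -- Splitting entry at `x`: the ear is glued to the second piece, so `t` becomes `t + 1`. Both
  -- branches of the comparison of the two decompositions reach this case.
  have key : l = l' → x :: y :: r = (s + t) :: r' →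
      IsSplit (l ++ (x + 1) :: (List.replicate (3 * k + 1) 1 ++ (y + 1) :: r)) := by
    rintro rfl h
    obtain ⟨rfl, rfl⟩ := List.cons.inj h
    exact ⟨l, _, s, t + 1, hl, EarList.ear [] r t y k hr, by rw [add_assoc]⟩
  rcases List.append_eq_append_iff.mp h with ⟨b, hb, h⟩ | ⟨b, hb, h⟩
  · rcases b with _ | ⟨x', _ | ⟨y', b⟩⟩
    · exact key (by simpa using hb.symm) h
    -- Splitting entry at `y`: the ear is glued to the end of the first piece.
    · simp only [List.cons_append, List.nil_append, List.cons.injEq] at h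
      obtain ⟨rfl, rfl, rfl⟩ := h
      subst hb
      refine ⟨l ++ (x + 1) :: List.replicate (3 * k + 1) 1, r, s + 1, t, ?_, hr, ?_⟩
      · have := EarList.ear l [] x s k (by simpa using hl)
        simpa using this
      · simp; ring
    · simp only [List.cons_append, List.cons.injEq] at h
      obtain ⟨rfl, rfl, rfl⟩ := h
      subst hb
      refine ⟨l ++ (x + 1) :: (List.replicate (3 * k + 1) 1 ++ (y + 1) :: b), r', s, t, ?_, hr, ?_⟩
      · have := EarList.ear l (b ++ [s]) x y k (by simpa using hl)
        simpa using this
      · simp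
  · rcases b with _ | ⟨z, b⟩
    · exact key (by simpa using hb) (by simpa using h.symm)
    · simp only [List.cons_append, List.cons.injEq] at h
      obtain ⟨rfl, rfl⟩ := h
      subst hb
      exact ⟨l', _, s, t, hl, EarList.ear (t :: b) r x y k hr, by simp⟩

/-- Cutting along a diagonal that ends at the first vertex. -/
theorem EarList.isSplit {u v : ℤ} {r : List ℤ} (h : EarList ((u + v) :: r)) (hu : 0 < u)
    (hv : 0 < v) : IsSplit (u :: r ++ [v]) := by
  generalize hL : (u + v) :: r = L at h
  induction h generalizing u v r with
  | base k =>
    rw [show 3 * k + 3 = (3 * k + 2) + 1 by ring, List.replicate_succ] at hL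
    have := (List.cons.inj hL).1
    omega
  | ear l r₀ x y k h ih =>
    rcases l with _ | ⟨a, l⟩
    · simp only [List.nil_append, List.cons.injEq] at hL
      obtain ⟨hx, rfl⟩ := hL
      -- The last ear touches the distinguished vertex. If `u = 1`, this ear alone is the first
      -- piece, and the second is the smaller tuple rotated by one place. Otherwise the ear counts
      -- towards `u`, and the smaller tuple is split with `u - 1`.
      rcases (show u = 1 ∨ 2 ≤ u by omega) with rfl | hu2
      · obtain rfl : v = x := by omega
        refine ⟨1 :: List.replicate (3 * k + 1) 1, r₀ ++ [v], 1, y, ?_, h.rotate, ?_⟩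
        · have := EarList.base k
          rwa [List.replicate_succ', List.replicate_succ] at this
        · simp [add_comm]
      · have h1 := ih (u := u - 1) (v := v) (r := y :: r₀) (by omega) hv
          (by rw [List.nil_append, show u - 1 + v = x by omega])
        have h2 := IsSplit.ear (l := []) (r := r₀ ++ [v]) h1 k
        simpa using h2
    · simp only [List.cons_append, List.cons.injEq] at hL
      obtain ⟨rfl, rfl⟩ := hL
      have h1 := ih hu hv rfl
      have h2 := IsSplit.ear (l := u :: l) (r := r₀ ++ [v]) (x := x) (y := y) (by simpa using h1) k
      simpa using h2


/-! ### Sides and diagonals of convex polygons. -/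

theorem isSide_univ_iff {N : ℕ} (p : Fin N × Fin N) :
    IsSide Finset.univ p ↔ (p.2 : ℕ) = p.1 + 1 ∨
      ((p.1 : ℕ) = 0 ∧ (p.2 : ℕ) + 1 = N ∧ p.1 < p.2) := by
  obtain ⟨⟨a, ha⟩, ⟨b, hb⟩⟩ := p
  simp only [IsSide, Finset.mem_univ, true_and, forall_const, Fin.lt_def, Fin.le_def]
  constructor
  · rintro ⟨hab, h | h⟩
    · left
      have := h ⟨a + 1, by omega⟩
      simp only at this
      omega
    · right
      have h0 := (h ⟨0, by omega⟩).1
      have h1 := (h ⟨N - 1, by omega⟩).2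
      simp only at h0 h1
      omega
  · rintro (h | ⟨h0, h1, h2⟩)
    · exact ⟨by omega, Or.inl fun k => by omega⟩
    · exact ⟨h2, Or.inr fun k => by omega⟩

theorem isDiagonal_univ_iff {N : ℕ} (p : Fin N × Fin N) :
    IsDiagonal Finset.univ p ↔ (p.1 : ℕ) + 1 < p.2 ∧ ((p.1 : ℕ) ≠ 0 ∨ (p.2 : ℕ) + 1 ≠ N) := by
  have := p.1.2
  have := p.2.2
  simp only [IsDiagonal, isSide_univ_iff, Finset.mem_univ, true_and, Fin.lt_def]
  omega

theorem IsSide.mono {N : ℕ} {S Q : Finset (Fin N)} {p : Fin N × Fin N} (h : IsSide Q p)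
    (hS : S ⊆ Q) (h1 : p.1 ∈ S) (h2 : p.2 ∈ S) : IsSide S p :=
  ⟨h1, h2, h.2.2.1, h.2.2.2.imp (fun h k hk => h k (hS hk)) fun h k hk => h k (hS hk)⟩

theorem isSide_map {N N' : ℕ} (φ : Fin N ↪o Fin N') (S : Finset (Fin N)) (p : Fin N × Fin N) :
    IsSide (S.map φ.toEmbedding) (φ p.1, φ p.2) ↔ IsSide S p := by
  simp [IsSide]

theorem crosses_map {N N' : ℕ} (φ : Fin N ↪o Fin N') (p q : Fin N × Fin N) :
    Crosses (φ p.1, φ p.2) (φ q.1, φ q.2) ↔ Crosses p q := by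
  simp [Crosses]

/-- A vertex which is not in `S` is cut off from `S` by a side of `S`. -/
theorem exists_isSide_separating {N : ℕ} {S : Finset (Fin N)} {k : Fin N} (hk : k ∉ S)
    (hS : 2 ≤ S.card) : ∃ p, IsSide S p ∧
      ((p.1 < k ∧ k < p.2 ∧ ∀ s ∈ S, s ≤ p.1 ∨ p.2 ≤ s) ∨
        ((k < p.1 ∨ p.2 < k) ∧ ∀ s ∈ S, p.1 ≤ s ∧ s ≤ p.2)) := by
  have hne : S.Nonempty := Finset.card_pos.mp (by omega)
  have hmm : S.min' hne < S.max' hne := Finset.min'_lt_max'_of_card S (by omega)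
  have outer : (k < S.min' hne ∨ S.max' hne < k) → ∃ p, IsSide S p ∧
      ((p.1 < k ∧ k < p.2 ∧ ∀ s ∈ S, s ≤ p.1 ∨ p.2 ≤ s) ∨
        ((k < p.1 ∨ p.2 < k) ∧ ∀ s ∈ S, p.1 ≤ s ∧ s ≤ p.2)) := by
    intro h
    have hall : ∀ s ∈ S, S.min' hne ≤ s ∧ s ≤ S.max' hne :=
      fun s hs => ⟨S.min'_le s hs, S.le_max' s hs⟩
    exact ⟨(S.min' hne, S.max' hne), ⟨S.min'_mem hne, S.max'_mem hne, hmm, Or.inr hall⟩,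
      Or.inr ⟨h, hall⟩⟩
  by_cases hA : (S.filter (· < k)).Nonempty
  · by_cases hB : (S.filter (k < ·)).Nonempty
    · have ha := Finset.max'_mem _ hA
      have hb := Finset.min'_mem _ hB
      have ha' := fun s hs => Finset.le_max' (S.filter (· < k)) s hs
      have hb' := fun s hs => Finset.min'_le (S.filter (k < ·)) s hs
      set a := Finset.max' _ hA
      set b := Finset.min' _ hB
      simp only [Finset.mem_filter] at ha hb ha' hb'
      have hall : ∀ s ∈ S, s ≤ a ∨ b ≤ s := by
        intro s hs
        rcases lt_trichotomy s k with h | rfl | h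
        · exact Or.inl (ha' s ⟨hs, h⟩)
        · exact absurd hs hk
        · exact Or.inr (hb' s ⟨hs, h⟩)
      exact ⟨(a, b), ⟨ha.1, hb.1, ha.2.trans hb.2, Or.inl hall⟩, Or.inl ⟨ha.2, hb.2, hall⟩⟩
    · refine outer (Or.inr ?_)
      rw [Finset.not_nonempty_iff_eq_empty, Finset.filter_eq_empty_iff] at hB
      exact lt_of_le_of_ne (not_lt.mp (hB (S.max'_mem hne)))
        fun h => hk (h ▸ S.max'_mem hne)
  · refine outer (Or.inl ?_)
    rw [Finset.not_nonempty_iff_eq_empty, Finset.filter_eq_empty_iff] at hA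
    exact lt_of_le_of_ne (not_lt.mp (hA (S.min'_mem hne))) fun h => hk (h ▸ S.min'_mem hne)

/-! ### Sub-polygons and restriction of a dissection. -/

namespace PolygonDissection

theorem mem_subpolygons {N : ℕ} {D : PolygonDissection N} {S : Finset (Fin N)} :
    S ∈ D.subpolygons ↔ D.IsSubpolygon S := by
  simp [subpolygons]

theorem ext_diagonals {N : ℕ} {D D' : PolygonDissection N} (h : D.diagonals = D'.diagonals) :
    D = D' := by
  cases D; cases D'; simp only at h; subst h; rfl

/-- A vertex of `Q` outside `S` is cut off by a side of `S`. This side has vertices of `Q` strictly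
on both sides of it, so it is a diagonal of `Q`. That is impossible both for a side of `P` and for a
diagonal of `D`. -/
theorem IsSubpolygon.eq_of_subset {N : ℕ} {D : PolygonDissection N} {S Q : Finset (Fin N)}
    (hS : D.IsSubpolygon S) (hQ : D.IsSubpolygon Q) (h : S ⊆ Q) : S = Q := by
  refine h.antisymm fun k hkQ => by_contra fun hkS => ?_
  obtain ⟨p, hp, hk⟩ := exists_isSide_separating hkS (by have := hS.1; omega)
  -- A third vertex of `S` provides the vertex of `Q` on the other side of `p`.
  have hpair : ¬ ∀ s ∈ S, s = p.1 ∨ s = p.2 := by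
    intro hs
    have h1 : S ⊆ {p.1, p.2} := fun s hs' => by simpa using hs s hs'
    have h2 := (Finset.card_le_card h1).trans Finset.card_le_two
    have := hS.1
    omega
  have hpQ : ¬ IsSide Q p := by
    rintro ⟨-, -, -, hp2⟩
    rcases hk with ⟨hk1, hk2, hk3⟩ | ⟨hk1, hk3⟩ <;> rcases hp2 with hp2 | hp2
    · rcases hp2 k hkQ with h | h
      · exact absurd hk1 (not_lt.mpr h)
      · exact absurd hk2 (not_lt.mpr h)
    · refine hpair fun s hs => ?_
      have := hp2 s (h hs)
      exact (hk3 s hs).imp (fun h => h.antisymm this.1) fun h => this.2.antisymm h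
    · refine hpair fun s hs => ?_
      have := hk3 s hs
      exact (hp2 s (h hs)).imp (fun h => h.antisymm this.1) fun h => this.2.antisymm h
    · have := hp2 k hkQ
      rcases hk1 with h | h
      · exact absurd h (not_lt.mpr this.1)
      · exact absurd h (not_lt.mpr this.2)
  rcases hS.2.1 p hp with hp' | hp'
  · exact hpQ (hp'.mono (Finset.subset_univ _) (h hp.1) (h hp.2.1))
  · exact hQ.2.2 p hp' ⟨h hp.1, h hp.2.1, hp.2.2.1, hpQ⟩

/-- A sub-polygon lies on one side of each diagonal of the decomposition. -/
theorem IsSubpolygon.one_side {N : ℕ} {D : PolygonDissection N} {S : Finset (Fin N)}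
    (hS : D.IsSubpolygon S) {i j : Fin N} (hd : (i, j) ∈ D.diagonals) :
    (∀ s ∈ S, i ≤ s ∧ s ≤ j) ∨ ∀ s ∈ S, s ≤ i ∨ j ≤ s := by
  by_contra! hcon
  obtain ⟨⟨t, ht, htij⟩, ⟨s, hs, his, hsj⟩⟩ := hcon
  have hij : i < j := his.trans hsj
  -- The strategy is to exhibit a crossing. If both ends of the diagonal lie in `S`, it cuts `S`,
  -- which is forbidden. If one end is missing, the side of `S` separating it from `S` must cross
  -- `(i, j)`.
  have hcross : ∀ p, IsSide S p → ¬ Crosses p (i, j) := by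
    intro p hp hc
    rcases hS.2.1 p hp with h | h
    · obtain ⟨-, -, -, h | h⟩ := h <;> rcases hc with ⟨h1, h2, h3⟩ | ⟨h1, h2, h3⟩ <;>
        have := h i (Finset.mem_univ _) <;> have := h j (Finset.mem_univ _) <;>
        simp only at * <;> omega
    · exact D.noncrossing p h _ hd hc
  have hcard : 2 ≤ S.card := by have := hS.1; omega
  have ht' : t < i ∨ j < t := by
    by_contra! h
    exact absurd (htij h.1) (not_lt.mpr h.2)
  by_cases hi : i ∈ S
  · by_cases hj : j ∈ S
    · refine hS.2.2 _ hd ⟨hi, hj, hij, ?_⟩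
      rintro ⟨-, -, -, h | h⟩
      · rcases h s hs with h | h
        · exact absurd his (not_lt.mpr h)
        · exact absurd hsj (not_lt.mpr h)
      · have := h t ht
        simp only at this
        omega
    · obtain ⟨p, hp, h⟩ := exists_isSide_separating hj hcard
      have hp1 := hp.1
      have hp2 := hp.2.1
      refine hcross p hp ?_
      unfold Crosses
      simp only
      rcases h with ⟨h1, h2, h3⟩ | ⟨h1, h3⟩ <;> have := h3 s hs <;> have := h3 t ht <;>
        have := h3 i hi <;> omega
  · obtain ⟨p, hp, h⟩ := exists_isSide_separating hi hcard
    refine hcross p hp ?_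
    unfold Crosses
    simp only
    rcases h with ⟨h1, h2, h3⟩ | ⟨h1, h3⟩ <;> have := h3 s hs <;> have := h3 t ht <;> omega

/-- The decomposition of a polygon cut out of `P`, whose vertices are the values of `φ`. -/
def restrict {N N' : ℕ} (D : PolygonDissection N') (φ : Fin N ↪o Fin N') :
    PolygonDissection N where
  diagonals := Finset.univ.filter fun p =>
    IsDiagonal Finset.univ p ∧ (φ p.1, φ p.2) ∈ D.diagonals
  isDiagonal p hp := (Finset.mem_filter.mp hp).2.1
  noncrossing p hp q hq := by
    rw [← crosses_map φ]
    exact D.noncrossing _ (Finset.mem_filter.mp hp).2.2 _ (Finset.mem_filter.mp hq).2.2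

theorem mem_restrict_diagonals {N N' : ℕ} {D : PolygonDissection N'} {φ : Fin N ↪o Fin N'}
    {p : Fin N × Fin N} : p ∈ (D.restrict φ).diagonals ↔
      IsDiagonal Finset.univ p ∧ (φ p.1, φ p.2) ∈ D.diagonals := by
  simp [restrict]

/-- The polygon with the values of `φ` as vertices is bounded by sides of `P` and by diagonals
of `D`. -/
def IsBounded {N N' : ℕ} (D : PolygonDissection N') (φ : Fin N ↪o Fin N') : Prop :=
  ∀ p : Fin N × Fin N, IsSide Finset.univ p →
    IsSide Finset.univ (φ p.1, φ p.2) ∨ (φ p.1, φ p.2) ∈ D.diagonals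

/-- The bounding chords of the cut-out polygon are dropped by `restrict`, as they become sides. The
boundedness hypothesis restores them when sides are transported back. -/
theorem IsBounded.isSubpolygon_restrict {N N' : ℕ} {D : PolygonDissection N'}
    {φ : Fin N ↪o Fin N'} (hφ : D.IsBounded φ) (S : Finset (Fin N)) :
    (D.restrict φ).IsSubpolygon S ↔ D.IsSubpolygon (S.map φ.toEmbedding) := by
  have hsides : (∀ p, IsSide S p → IsSide Finset.univ p ∨ p ∈ (D.restrict φ).diagonals) ↔
      ∀ p, IsSide (S.map φ.toEmbedding) p → IsSide Finset.univ p ∨ p ∈ D.diagonals := by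
    constructor
    · rintro h ⟨a, b⟩ hp
      obtain ⟨a', -, rfl⟩ := Finset.mem_map.mp hp.1
      obtain ⟨b', -, rfl⟩ := Finset.mem_map.mp hp.2.1
      rcases h (a', b') ((isSide_map φ S (a', b')).mp hp) with h | h
      · exact hφ _ h
      · exact Or.inr (mem_restrict_diagonals.mp h).2
    · intro h p hp
      by_cases hu : IsSide Finset.univ p
      · exact Or.inl hu
      · right
        refine mem_restrict_diagonals.mpr
          ⟨⟨Finset.mem_univ _, Finset.mem_univ _, hp.2.2.1, hu⟩, ?_⟩
        refine (h _ ((isSide_map φ S p).mpr hp)).resolve_left fun h' => hu ?_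
        refine (isSide_map φ _ p).mp (h'.mono (Finset.subset_univ _) ?_ ?_) <;> simp
  have hdiag : (∀ p ∈ (D.restrict φ).diagonals, ¬ IsDiagonal S p) ↔
      ∀ p ∈ D.diagonals, ¬ IsDiagonal (S.map φ.toEmbedding) p := by
    constructor
    · rintro h ⟨a, b⟩ hp hd
      obtain ⟨a', ha', rfl⟩ := Finset.mem_map.mp hd.1
      obtain ⟨b', hb', rfl⟩ := Finset.mem_map.mp hd.2.1
      have hab : a' < b' := φ.lt_iff_lt.mp hd.2.2.1
      have hs : ¬ IsSide S (a', b') := fun hs => hd.2.2.2 ((isSide_map φ S (a', b')).mpr hs)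
      refine h (a', b') (mem_restrict_diagonals.mpr
        ⟨⟨Finset.mem_univ _, Finset.mem_univ _, hab, fun hu => hs ?_⟩, hp⟩) ⟨ha', hb', hab, hs⟩
      exact hu.mono (Finset.subset_univ _) ha' hb'
    · intro h p hp hd
      refine h _ (mem_restrict_diagonals.mp hp).2 ⟨?_, ?_, φ.lt_iff_lt.mpr hd.2.2.1, ?_⟩
      · simpa using hd.1
      · simpa using hd.2.1
      · exact fun hs => hd.2.2.2 ((isSide_map φ S p).mp hs)
  unfold IsSubpolygon
  rw [Finset.card_map, hsides, hdiag]

/-- The number of sub-polygons containing each vertex. -/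
def quiddity {N : ℕ} (D : PolygonDissection N) (k : Fin N) : ℤ :=
  (D.subpolygons.filter (k ∈ ·)).card

/-- Every sub-polygon has a number of vertices divisible by 3. -/
def IsThreeD {N : ℕ} (D : PolygonDissection N) : Prop :=
  ∀ S ∈ D.subpolygons, 3 ∣ S.card

theorem IsBounded.isThreeD_restrict {N N' : ℕ} {D : PolygonDissection N'}
    {φ : Fin N ↪o Fin N'} (hφ : D.IsBounded φ)
    (h : ∀ S ∈ D.subpolygons, (∀ s ∈ S, s ∈ Set.range φ) → 3 ∣ S.card) :
    (D.restrict φ).IsThreeD := by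
  intro S hS
  rw [mem_subpolygons, hφ.isSubpolygon_restrict] at hS
  have := h _ (mem_subpolygons.mpr hS) fun s hs => by
    obtain ⟨t, -, rfl⟩ := Finset.mem_map.mp hs
    exact ⟨t, rfl⟩
  rwa [Finset.card_map] at this

theorem exists_map_eq {N N' : ℕ} (φ : Fin N ↪o Fin N') {S : Finset (Fin N')}
    (h : ∀ s ∈ S, s ∈ Set.range φ) : ∃ S' : Finset (Fin N), S'.map φ.toEmbedding = S := by
  refine ⟨Finset.univ.filter (φ · ∈ S), ?_⟩
  ext s
  simp only [Finset.mem_map, Finset.mem_filter, Finset.mem_univ, true_and]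
  constructor
  · rintro ⟨t, ht, rfl⟩
    exact ht
  · intro hs
    obtain ⟨t, rfl⟩ := h s hs
    exact ⟨t, hs, rfl⟩

theorem IsBounded.quiddity_restrict {N N' : ℕ} {D : PolygonDissection N'}
    {φ : Fin N ↪o Fin N'} (hφ : D.IsBounded φ) (k : Fin N) : (D.restrict φ).quiddity k =
      (D.subpolygons.filter fun S => φ k ∈ S ∧ ∀ s ∈ S, s ∈ Set.range φ).card := by
  classical
  unfold quiddity
  norm_cast
  refine Finset.card_bij (fun S _ => S.map φ.toEmbedding) ?_ ?_ ?_
  · intro S hS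
    simp only [Finset.mem_filter, mem_subpolygons, hφ.isSubpolygon_restrict] at hS ⊢
    refine ⟨hS.1, by simpa using hS.2, fun s hs => ?_⟩
    obtain ⟨t, -, rfl⟩ := Finset.mem_map.mp hs
    exact ⟨t, rfl⟩
  · intro S _ S' _ h
    exact Finset.map_injective _ h
  · intro S hS
    simp only [Finset.mem_filter, mem_subpolygons] at hS
    obtain ⟨S', rfl⟩ := exists_map_eq φ hS.2.2
    refine ⟨S', ?_, rfl⟩
    simp only [Finset.mem_filter, mem_subpolygons, hφ.isSubpolygon_restrict]
    exact ⟨hS.1, by simpa using hS.2.1⟩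

theorem isSubpolygon_iff_of_diagonals_eq_empty {N : ℕ} (hN : 3 ≤ N) {D : PolygonDissection N}
    (hD : D.diagonals = ∅) (S : Finset (Fin N)) : D.IsSubpolygon S ↔ S = Finset.univ := by
  have hu : D.IsSubpolygon Finset.univ :=
    ⟨by simpa using hN, fun p hp => Or.inl hp, by simp [hD]⟩
  exact ⟨fun h => h.eq_of_subset hu (Finset.subset_univ _), fun h => h ▸ hu⟩

end PolygonDissection


/-! ### Extending dissections and isolating sub-polygons. -/

theorem Crosses.symm {N : ℕ} {p q : Fin N × Fin N} (h : Crosses p q) : Crosses q p := Or.symm h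

theorem not_crosses_self {N : ℕ} (p : Fin N × Fin N) : ¬ Crosses p p := by
  simp [Crosses]

theorem IsDiagonal.map {N N' : ℕ} {p : Fin N × Fin N} (h : IsDiagonal Finset.univ p)
    (φ : Fin N ↪o Fin N') : IsDiagonal Finset.univ (φ p.1, φ p.2) := by
  refine ⟨Finset.mem_univ _, Finset.mem_univ _, φ.lt_iff_lt.mpr h.2.2.1, fun hs => h.2.2.2 ?_⟩
  refine (isSide_map φ _ p).mp (hs.mono (Finset.subset_univ _) ?_ ?_) <;> simp

theorem List.exists_eq_append_cons_cons {α : Type*} (L : List α) {i : ℕ} (h : i + 1 < L.length) :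
    ∃ l x y r, L = l ++ x :: y :: r ∧ l.length = i := by
  refine ⟨L.take i, L[i], L[i + 1], L.drop (i + 2), ?_, by simp; omega⟩
  conv_lhs => rw [← List.take_append_drop i L]
  rw [List.drop_eq_getElem_cons (by omega), List.drop_eq_getElem_cons (by omega)]

namespace PolygonDissection

/-- A diagonal with no other diagonal under it cuts off a whole sub-polygon, the ear. -/
theorem isSubpolygon_Icc {N : ℕ} {D : PolygonDissection N} {a b : Fin N}
    (hab : (a, b) ∈ D.diagonals)
    (hmin : ∀ p ∈ D.diagonals, a ≤ p.1 → p.2 ≤ b → p = (a, b)) :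
    D.IsSubpolygon (Finset.Icc a b) := by
  have hd := (isDiagonal_univ_iff _).mp (D.isDiagonal _ hab)
  simp only at hd
  refine ⟨by rw [Fin.card_Icc]; omega, fun p hp => ?_, fun p hp hdp => ?_⟩
  · obtain ⟨h1, h2, h3, h4⟩ := hp
    rw [Finset.mem_Icc] at h1 h2
    rcases h4 with h4 | h4
    · left
      rw [isSide_univ_iff]
      left
      have := h4 ⟨p.1 + 1, by omega⟩ (Finset.mem_Icc.mpr (by simp only [Fin.le_def]; omega))
      simp only [Fin.le_def] at this
      omega
    · right
      have ha := h4 a (Finset.mem_Icc.mpr (by omega))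
      have hb := h4 b (Finset.mem_Icc.mpr (by omega))
      have : p = (a, b) := Prod.ext (le_antisymm ha.1 h1.1) (le_antisymm h2.2 hb.2)
      rwa [this]
  · obtain rfl := hmin p hp (Finset.mem_Icc.mp hdp.1).1 (Finset.mem_Icc.mp hdp.2.1).2
    exact hdp.2.2.2 ⟨hdp.1, hdp.2.1, hdp.2.2.1, Or.inr fun k hk => Finset.mem_Icc.mp hk⟩

/-- The image of a decomposition under `φ`, with further diagonals. -/
def extend {N N' : ℕ} (D : PolygonDissection N) (φ : Fin N ↪o Fin N')
    (E : Finset (Fin N' × Fin N')) (hE : ∀ e ∈ E, IsDiagonal Finset.univ e)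
    (hEE : ∀ e ∈ E, ∀ e' ∈ E, ¬ Crosses e e')
    (hDE : ∀ e ∈ E, ∀ p : Fin N × Fin N, ¬ Crosses (φ p.1, φ p.2) e) :
    PolygonDissection N' where
  diagonals := D.diagonals.image (fun p => (φ p.1, φ p.2)) ∪ E
  isDiagonal p hp := by
    rcases Finset.mem_union.mp hp with hp | hp
    · obtain ⟨q, hq, rfl⟩ := Finset.mem_image.mp hp
      exact (D.isDiagonal q hq).map φ
    · exact hE p hp
  noncrossing p hp q hq := by
    rcases Finset.mem_union.mp hp with hp | hp <;> rcases Finset.mem_union.mp hq with hq | hq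
    · obtain ⟨p', hp', rfl⟩ := Finset.mem_image.mp hp
      obtain ⟨q', hq', rfl⟩ := Finset.mem_image.mp hq
      rw [crosses_map]
      exact D.noncrossing _ hp' _ hq'
    · obtain ⟨p', hp', rfl⟩ := Finset.mem_image.mp hp
      exact hDE q hq p'
    · obtain ⟨q', hq', rfl⟩ := Finset.mem_image.mp hq
      exact fun h => hDE p hp q' h.symm
    · exact hEE p hp q hq

section extend

variable {N N' : ℕ} {D : PolygonDissection N} {φ : Fin N ↪o Fin N'}
    {E : Finset (Fin N' × Fin N')} {hE : ∀ e ∈ E, IsDiagonal Finset.univ e}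
    {hEE : ∀ e ∈ E, ∀ e' ∈ E, ¬ Crosses e e'}
    {hDE : ∀ e ∈ E, ∀ p : Fin N × Fin N, ¬ Crosses (φ p.1, φ p.2) e}

theorem mem_extend_diagonals {p : Fin N' × Fin N'} : p ∈ (D.extend φ E hE hEE hDE).diagonals ↔
    (∃ q ∈ D.diagonals, (φ q.1, φ q.2) = p) ∨ p ∈ E := by
  simp only [extend, Finset.mem_union, Finset.mem_image]

theorem restrict_extend (h : ∀ p, IsDiagonal Finset.univ p → (φ p.1, φ p.2) ∈ E →
    p ∈ D.diagonals) : (D.extend φ E hE hEE hDE).restrict φ = D := by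
  refine ext_diagonals (Finset.ext fun p => ?_)
  rw [mem_restrict_diagonals, mem_extend_diagonals]
  constructor
  · rintro ⟨hp, ⟨q, hq, hqp⟩ | hp'⟩
    · have : q = p := Prod.ext (φ.injective (congrArg Prod.fst hqp))
        (φ.injective (congrArg Prod.snd hqp))
      exact this ▸ hq
    · exact h p hp hp'
  · exact fun hp => ⟨D.isDiagonal p hp, Or.inl ⟨p, hp, rfl⟩⟩

end extend

/-! ### Removing and gluing an ear. -/

/-- The order embedding that leaves out `m` vertices after the vertex `i`. -/
def skip (N i m : ℕ) : Fin N ↪o Fin (N + m) :=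
  OrderEmbedding.ofStrictMono
    (fun k => if (k : ℕ) ≤ i then ⟨k, by omega⟩ else ⟨k + m, by omega⟩) (by
      intro a b hab
      simp only [Fin.lt_def] at hab ⊢
      split_ifs <;> simp only <;> omega)

theorem skip_val (N i m : ℕ) (k : Fin N) :
    (skip N i m k : ℕ) = if (k : ℕ) ≤ i then (k : ℕ) else k + m :=
  apply_ite Fin.val _ _ _

theorem mem_range_skip {N i m : ℕ} (hi : i + 1 < N) (s : Fin (N + m)) :
    s ∈ Set.range (skip N i m) ↔ (s : ℕ) ≤ i ∨ i + m + 1 ≤ s := by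
  constructor
  · rintro ⟨t, rfl⟩
    rw [skip_val]
    split_ifs <;> omega
  · rintro (h | h)
    · refine ⟨⟨s, by omega⟩, Fin.ext ?_⟩
      rw [skip_val, if_pos h]
    · refine ⟨⟨s - m, by omega⟩, Fin.ext ?_⟩
      rw [skip_val, if_neg (by simp only; omega)]
      simp only; omega

theorem quiddity_eq_add {N N' : ℕ} {D : PolygonDissection N'} {φ : Fin N ↪o Fin N'}
    (hφ : D.IsBounded φ) (k : Fin N) : D.quiddity (φ k) = (D.restrict φ).quiddity k +
      (D.subpolygons.filter fun S => φ k ∈ S ∧ ¬ ∀ s ∈ S, s ∈ Set.range φ).card := by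
  classical
  rw [hφ.quiddity_restrict]
  unfold quiddity
  norm_cast
  rw [← Finset.filter_filter, ← Finset.filter_filter, Finset.card_filter_add_card_filter_not]

section ear

variable {N i m : ℕ} {D : PolygonDissection (N + m)} (hi : i + 1 < N) (hm : 0 < m)
  (hd : (⟨i, by omega⟩, ⟨i + m + 1, by omega⟩) ∈ D.diagonals)
  (hmin : ∀ p ∈ D.diagonals, i ≤ (p.1 : ℕ) → (p.2 : ℕ) ≤ i + m + 1 →
    p = (⟨i, by omega⟩, ⟨i + m + 1, by omega⟩))

include hm hd in
theorem isBounded_skip : D.IsBounded (skip N i m) := by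
  intro p hp
  rw [isSide_univ_iff] at hp ⊢
  simp only [skip_val, Fin.lt_def]
  by_cases h : (p.1 : ℕ) = i ∧ (p.2 : ℕ) = i + 1
  · right
    convert hd using 2
    · refine Fin.ext ?_
      rw [skip_val, if_pos (by omega)]; exact h.1
    · refine Fin.ext ?_
      rw [skip_val, if_neg (by omega)]; simp only; omega
  · left
    split_ifs <;> omega

include hi hm hd hmin

/-- Each sub-polygon lies on one side of the ear diagonal, and the only one on the ear's side is the
ear itself, by maximality. -/
theorem subpolygon_eq_Icc_iff {S : Finset (Fin (N + m))} (hS : D.IsSubpolygon S) :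
    S = Finset.Icc ⟨i, by omega⟩ ⟨i + m + 1, by omega⟩ ↔
      ¬ ∀ s ∈ S, s ∈ Set.range (skip N i m) := by
  constructor
  · rintro rfl h
    have := h ⟨i + 1, by omega⟩ (Finset.mem_Icc.mpr (by simp only [Fin.le_def]; omega))
    rw [mem_range_skip hi] at this
    simp only at this
    omega
  · intro h
    refine hS.eq_of_subset (isSubpolygon_Icc hd hmin) ?_
    rcases hS.one_side hd with h' | h'
    · exact fun s hs => Finset.mem_Icc.mpr (h' s hs)
    · exact absurd (fun s hs => (mem_range_skip hi s).mpr (h' s hs)) h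

theorem filter_eq_ear (v : Fin (N + m)) :
    (D.subpolygons.filter fun S => v ∈ S ∧ ¬ ∀ s ∈ S, s ∈ Set.range (skip N i m)) =
      if i ≤ (v : ℕ) ∧ (v : ℕ) ≤ i + m + 1 then
        {Finset.Icc ⟨i, by omega⟩ ⟨i + m + 1, by omega⟩} else ∅ := by
  ext S
  have hI := isSubpolygon_Icc hd hmin
  simp only [Finset.mem_filter, mem_subpolygons]
  constructor
  · rintro ⟨hS, hv, h⟩
    obtain rfl := (subpolygon_eq_Icc_iff hi hm hd hmin hS).mpr h
    rw [if_pos (by simpa [Fin.le_def] using hv)]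
    exact Finset.mem_singleton_self _
  · intro h
    split_ifs at h with hv
    · obtain rfl := Finset.mem_singleton.mp h
      exact ⟨hI, Finset.mem_Icc.mpr hv, (subpolygon_eq_Icc_iff hi hm hd hmin hI).mp rfl⟩
    · exact absurd h (Finset.notMem_empty _)

theorem quiddity_skip (k : Fin N) : D.quiddity (skip N i m k) =
    (D.restrict (skip N i m)).quiddity k + if (k : ℕ) = i ∨ (k : ℕ) = i + 1 then 1 else 0 := by
  rw [quiddity_eq_add (isBounded_skip hi hm hd), filter_eq_ear hi hm hd hmin, skip_val]
  split_ifs <;> first | rfl | (exfalso; omega)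

theorem quiddity_ear (v : Fin (N + m)) (h1 : i < v) (h2 : v < i + m + 1) :
    D.quiddity v = 1 := by
  have : D.subpolygons.filter (v ∈ ·) =
      {Finset.Icc ⟨i, by omega⟩ ⟨i + m + 1, by omega⟩} := by
    rw [← (filter_eq_ear hi hm hd hmin v).trans (if_pos (by omega))]
    refine Finset.filter_congr fun S _ => ⟨fun hv => ⟨hv, fun h => ?_⟩, fun h => h.1⟩
    have := (mem_range_skip hi v).mp (h v hv)
    omega
  rw [quiddity, this]; rfl

theorem isThreeD_ear (h3 : 3 ∣ m + 2) :
    D.IsThreeD ↔ (D.restrict (skip N i m)).IsThreeD := by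
  constructor
  · exact fun h => (isBounded_skip hi hm hd).isThreeD_restrict fun S hS _ => h S hS
  · intro h S hS
    rw [mem_subpolygons] at hS
    by_cases hr : ∀ s ∈ S, s ∈ Set.range (skip N i m)
    · obtain ⟨S', rfl⟩ := exists_map_eq _ hr
      rw [← (isBounded_skip hi hm hd).isSubpolygon_restrict] at hS
      rw [Finset.card_map]
      exact h S' (mem_subpolygons.mpr hS)
    · rw [(subpolygon_eq_Icc_iff hi hm hd hmin hS).mpr hr, Fin.card_Icc]
      simp only
      convert h3 using 1; omega

theorem ofFn_quiddity_ear {l r : List ℤ} {x y : ℤ} (hl : l.length = i)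
    (h : List.ofFn (D.restrict (skip N i m)).quiddity = l ++ x :: y :: r) :
    List.ofFn D.quiddity = l ++ (x + 1) :: (List.replicate m 1 ++ (y + 1) :: r) := by
  have hlen : N = l.length + (r.length + 1 + 1) := by simpa using congrArg List.length h
  have hq : ∀ (k : ℕ) (hk : k < N), (D.restrict (skip N i m)).quiddity ⟨k, hk⟩ =
      (l ++ x :: y :: r)[k]'(by simp; omega) := by
    intro k hk
    simp [← h]
  have hsk : ∀ (k : ℕ) (hk : k < N) (k' : ℕ) (hk' : k' < N + m),
      k' = (if k ≤ i then k else k + m) → D.quiddity ⟨k', hk'⟩ =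
        (l ++ x :: y :: r)[k]'(by simp; omega) + if k = i ∨ k = i + 1 then 1 else 0 := by
    intro k hk k' hk' hkk
    have := quiddity_skip hi hm hd hmin ⟨k, hk⟩
    rw [hq] at this
    rw [← this]
    congr 1
    refine Fin.ext ?_
    rw [skip_val]
    exact hkk
  refine List.ext_getElem (by simp; omega) fun k hk hk' => ?_
  have hkN : k < N + m := by simpa using hk
  rw [List.getElem_ofFn]
  subst hl
  rcases lt_trichotomy k l.length with hkl | rfl | hkl
  · rw [hsk k (by omega) k hkN (by rw [if_pos (by omega)]), if_neg (by omega)]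
    rw [List.getElem_append_left hkl, List.getElem_append_left hkl, add_zero]
  · rw [hsk l.length (by omega) l.length hkN (by rw [if_pos le_rfl]), if_pos (by omega)]
    simp
  · obtain ⟨t, rfl⟩ : ∃ t, k = l.length + (t + 1) := ⟨k - l.length - 1, by omega⟩
    rw [List.getElem_append_right (by omega)]
    simp only [Nat.add_sub_cancel_left, List.getElem_cons_succ]
    rcases lt_trichotomy t m with htm | rfl | htm
    · rw [quiddity_ear hi hm hd hmin _ (by simp only; omega) (by simp only; omega),
        List.getElem_append_left (by simpa using htm), List.getElem_replicate]
    · rw [hsk (l.length + 1) (by omega) _ hkN (by rw [if_neg (by omega)]; omega),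
        if_pos (by omega)]
      simp
    · obtain ⟨u, rfl⟩ : ∃ u, t = m + (u + 1) := ⟨t - m - 1, by omega⟩
      rw [hsk (l.length + (u + 1 + 1)) (by omega) _ hkN (by rw [if_neg (by omega)]; omega),
        if_neg (by omega), List.getElem_append_right (by omega),
        List.getElem_append_right (by simp)]
      simp

end ear

/-! ### Quiddities of 3d-dissections. -/

theorem ofFn_quiddity_of_diagonals_eq_empty {N : ℕ} (hN : 3 ≤ N) {D : PolygonDissection N}
    (hD : D.diagonals = ∅) : List.ofFn D.quiddity = List.replicate N 1 := by
  have hs : D.subpolygons = {Finset.univ} := by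
    ext S
    rw [mem_subpolygons, isSubpolygon_iff_of_diagonals_eq_empty hN hD, Finset.mem_singleton]
  rw [← List.ofFn_const]
  congr 1
  funext k
  rw [quiddity, hs, Finset.filter_singleton, if_pos (Finset.mem_univ _)]
  rfl

/-- The quiddity of a dissection into polygons with a number of vertices divisible by 3. -/
theorem IsThreeD.earList {N : ℕ} (hN : 3 ≤ N) {D : PolygonDissection N} (h : D.IsThreeD) :
    EarList (List.ofFn D.quiddity) := by
  induction N using Nat.strong_induction_on with
  | _ N ih =>
    rcases D.diagonals.eq_empty_or_nonempty with hD | hD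
    · rw [ofFn_quiddity_of_diagonals_eq_empty hN hD]
      have : 3 ∣ N := by
        have := h Finset.univ
          (mem_subpolygons.mpr ((isSubpolygon_iff_of_diagonals_eq_empty hN hD _).mpr rfl))
        simpa using this
      obtain ⟨k, rfl⟩ := this
      rw [show 3 * k = 3 * (k - 1) + 3 by omega]
      exact EarList.base _
    -- A diagonal of least length `j - i` has no other diagonal under it. With `m` vertices strictly
    -- between its ends, the ear has `m + 2` vertices, hence `m = 3 * k + 1`.
    · obtain ⟨⟨⟨i, hi⟩, ⟨j, hj⟩⟩, hd, hmin⟩ :=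
        D.diagonals.exists_min_image (fun p => (p.2 : ℕ) - p.1) hD
      have hij := (isDiagonal_univ_iff _).mp (D.isDiagonal _ hd)
      simp only at hij hmin
      obtain ⟨m, rfl⟩ : ∃ m, j = i + m + 1 := ⟨j - i - 1, by omega⟩
      obtain ⟨N, rfl⟩ : ∃ N', N = N' + m := ⟨N - m, by omega⟩
      have hi' : i + 1 < N := by omega
      have hm : 0 < m := by omega
      have hmin' : ∀ p ∈ D.diagonals, i ≤ (p.1 : ℕ) → (p.2 : ℕ) ≤ i + m + 1 →
          p = (⟨i, by omega⟩, ⟨i + m + 1, by omega⟩) := by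
        intro p hp h1 h2
        have h3 := hmin p hp
        have h4 : (p.1 : ℕ) < p.2 := (D.isDiagonal p hp).2.2.1
        exact Prod.ext (Fin.ext (by simp only; omega)) (Fin.ext (by simp only; omega))
      have hI := h _ (mem_subpolygons.mpr (isSubpolygon_Icc hd hmin'))
      rw [Fin.card_Icc] at hI
      simp only at hI
      have h3 : 3 ∣ m + 2 := by convert hI using 1; omega
      have hR := ih N (by omega) (by omega) ((isThreeD_ear hi' hm hd hmin' h3).mp h)
      obtain ⟨l, x, y, r, hL, hl⟩ := List.exists_eq_append_cons_cons
        (List.ofFn (D.restrict (skip N i m)).quiddity) (i := i) (by simpa using hi')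
      rw [ofFn_quiddity_ear hi' hm hd hmin' hl hL, show m = 3 * (m / 3) + 1 by omega]
      rw [hL] at hR
      exact EarList.ear _ _ _ _ _ hR

/-- Every `EarList` is the quiddity of a dissection. -/
theorem exists_of_earList {L : List ℤ} (h : EarList L) {N : ℕ} (hN : L.length = N) :
    3 ≤ N ∧ ∃ D : PolygonDissection N, D.IsThreeD ∧ List.ofFn D.quiddity = L := by
  induction h generalizing N with
  | base k =>
    obtain rfl : 3 * k + 3 = N := by simpa using hN
    refine ⟨by omega, ⟨∅, by simp, by simp⟩, fun S hS => ?_,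
      ofFn_quiddity_of_diagonals_eq_empty (by omega) rfl⟩
    rw [mem_subpolygons, isSubpolygon_iff_of_diagonals_eq_empty (by omega) rfl] at hS
    rw [hS, Finset.card_univ, Fintype.card_fin]
    exact ⟨k + 1, by ring⟩
  | ear l r x y k h ih =>
    obtain ⟨N₀, hN₀'⟩ : ∃ N₀, N₀ = l.length + (r.length + 1 + 1) := ⟨_, rfl⟩
    obtain ⟨hN₀, D, hD, hL⟩ := ih (N := N₀) (by simp [hN₀'])
    obtain rfl : N₀ + (3 * k + 1) = N := by
      rw [← hN]; simp; omega
    refine ⟨by omega, ?_⟩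
    have hi : l.length + 1 < N₀ := by omega
    let d : Fin (N₀ + (3 * k + 1)) × Fin (N₀ + (3 * k + 1)) :=
      (⟨l.length, by omega⟩, ⟨l.length + (3 * k + 1) + 1, by omega⟩)
    have hmemd : ∀ e, e ∈ ({d} : Finset _) ↔ e = d := fun e => Finset.mem_singleton
    let D' := D.extend (skip N₀ l.length (3 * k + 1)) {d}
      (by
        intro e he
        rw [hmemd] at he
        subst he
        rw [isDiagonal_univ_iff]
        simp only [d]
        omega)
      (by
        intro e he e' he'
        rw [hmemd] at he he'
        subst he
        subst he'
        exact not_crosses_self _)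
      (by
        intro e he p
        rw [hmemd] at he
        subst he
        simp only [Crosses, Fin.lt_def, skip_val, d]
        split_ifs <;> omega)
    -- The new diagonal pulls back to a side of the smaller polygon, so the restriction forgets it.
    have hR : D'.restrict (skip N₀ l.length (3 * k + 1)) = D := by
      refine restrict_extend fun p hp hpd => ?_
      exfalso
      rw [hmemd] at hpd
      rw [isDiagonal_univ_iff] at hp
      have h1 := congrArg (fun e => (e.1 : ℕ)) hpd
      have h2 := congrArg (fun e => (e.2 : ℕ)) hpd
      simp only [skip_val, d] at h1 h2
      split_ifs at h1 h2 <;> omega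
    have hd : d ∈ D'.diagonals := mem_extend_diagonals.mpr (Or.inr (by simp))
    have hmin : ∀ p ∈ D'.diagonals, l.length ≤ (p.1 : ℕ) →
        (p.2 : ℕ) ≤ l.length + (3 * k + 1) + 1 → p = d := by
      intro p hp h1 h2
      rcases mem_extend_diagonals.mp hp with ⟨q, hq, rfl⟩ | hp
      · exfalso
        have := (isDiagonal_univ_iff q).mp (D.isDiagonal q hq)
        simp only [skip_val] at h1 h2
        split_ifs at h1 h2 <;> omega
      · exact (hmemd p).mp hp
    refine ⟨D', (isThreeD_ear hi (by omega) hd hmin ⟨k + 1, by ring⟩).mpr (by rwa [hR]),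
      ofFn_quiddity_ear hi (by omega) hd hmin rfl (by rwa [hR])⟩

end PolygonDissection


/-! ### Explicit triangles and quadrilaterals. -/

section triangle

variable {N : ℕ} {a b c : Fin N}

theorem isSide_triple_iff (hab : a < b) (hbc : b < c) (p : Fin N × Fin N) :
    IsSide {a, b, c} p ↔ p = (a, b) ∨ p = (b, c) ∨ p = (a, c) := by
  obtain ⟨u, v⟩ := p
  simp only [IsSide, Finset.mem_insert, Finset.mem_singleton, forall_eq_or_imp, forall_eq]
  simp only [Prod.mk.injEq, Fin.lt_def, Fin.le_def, Fin.ext_iff] at *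
  omega

theorem isSide_quadruple_iff {d : Fin N} (hab : a < b) (hbc : b < c) (hcd : c < d)
    (p : Fin N × Fin N) :
    IsSide {a, b, c, d} p ↔ p = (a, b) ∨ p = (b, c) ∨ p = (c, d) ∨ p = (a, d) := by
  obtain ⟨u, v⟩ := p
  simp only [IsSide, Finset.mem_insert, Finset.mem_singleton, forall_eq_or_imp, forall_eq]
  simp only [Prod.mk.injEq, Fin.lt_def, Fin.le_def, Fin.ext_iff] at *
  omega

theorem isDiagonal_quadruple_iff {d : Fin N} (hab : a < b) (hbc : b < c) (hcd : c < d)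
    (p : Fin N × Fin N) : IsDiagonal {a, b, c, d} p ↔ p = (a, c) ∨ p = (b, d) := by
  rw [IsDiagonal, isSide_quadruple_iff hab hbc hcd]
  obtain ⟨u, v⟩ := p
  simp only [Finset.mem_insert, Finset.mem_singleton,
    Prod.mk.injEq, Fin.lt_def, Fin.ext_iff] at *
  omega

theorem card_triple (hab : a < b) (hbc : b < c) : ({a, b, c} : Finset (Fin N)).card = 3 := by
  rw [Finset.card_eq_three]
  exact ⟨a, b, c, hab.ne, (hab.trans hbc).ne, hbc.ne, rfl⟩

theorem card_quadruple {d : Fin N} (hab : a < b) (hbc : b < c) (hcd : c < d) :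
    ({a, b, c, d} : Finset (Fin N)).card = 4 := by
  rw [Finset.card_insert_of_notMem, card_triple hbc hcd]
  simp only [Finset.mem_insert, Finset.mem_singleton]
  omega

theorem eq_triple_of_card {U : Finset (Fin N)} (h : U.card = 3) (ha : a ∈ U) (hb : b ∈ U)
    (hab : a ≠ b) : ∃ c, c ≠ a ∧ c ≠ b ∧ U = {a, c, b} := by
  obtain ⟨c, hc, hc'⟩ := Finset.exists_mem_notMem_of_card_lt_card
    (s := {a, b}) (t := U) (by rw [h, Finset.card_pair hab]; norm_num)
  simp only [Finset.mem_insert, Finset.mem_singleton, not_or] at hc'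
  refine ⟨c, hc'.1, hc'.2, (Finset.eq_of_subset_of_card_le ?_ ?_).symm⟩
  · intro x hx
    simp only [Finset.mem_insert, Finset.mem_singleton] at hx
    rcases hx with rfl | rfl | rfl <;> assumption
  · rw [h, Finset.card_eq_three.mpr ⟨a, c, b, Ne.symm hc'.1, hab, hc'.2, rfl⟩]

end triangle

namespace PolygonDissection

theorem isSubpolygon_triple {N : ℕ} {D : PolygonDissection N} {a b c : Fin N} (hab : a < b)
    (hbc : b < c) (h1 : IsSide Finset.univ (a, b) ∨ (a, b) ∈ D.diagonals)
    (h2 : IsSide Finset.univ (b, c) ∨ (b, c) ∈ D.diagonals)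
    (h3 : IsSide Finset.univ (a, c) ∨ (a, c) ∈ D.diagonals) : D.IsSubpolygon {a, b, c} := by
  refine ⟨(card_triple hab hbc).ge, fun p hp => ?_, fun p _ hp => hp.2.2.2 ?_⟩
  · rcases (isSide_triple_iff hab hbc p).mp hp with rfl | rfl | rfl <;> assumption
  · obtain ⟨hp1, hp2, hp3, -⟩ := hp
    rw [isSide_triple_iff hab hbc]
    obtain ⟨u, v⟩ := p
    simp only [Finset.mem_insert, Finset.mem_singleton,
      Prod.mk.injEq, Fin.lt_def, Fin.ext_iff] at *
    omega

/-! ### Sub-polygons on an interval of vertices. -/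

/-- The order embedding onto the vertices `s, …, s + N - 1`. -/
def shift {N N' : ℕ} (s : ℕ) (h : N + s ≤ N') : Fin N ↪o Fin N' :=
  OrderEmbedding.ofStrictMono (fun k => ⟨k + s, by omega⟩)
    (fun _ _ hab => Nat.add_lt_add_right hab s)

theorem shift_val {N N' : ℕ} (s : ℕ) (h : N + s ≤ N') (k : Fin N) :
    (shift s h k : ℕ) = k + s := rfl

theorem mem_range_shift {N N' : ℕ} {s : ℕ} {h : N + s ≤ N'} {v : Fin N'} :
    v ∈ Set.range (shift s h) ↔ s ≤ v ∧ (v : ℕ) < s + N := by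
  constructor
  · rintro ⟨t, rfl⟩
    rw [shift_val]
    omega
  · rintro ⟨h1, h2⟩
    refine ⟨⟨v - s, by omega⟩, Fin.ext ?_⟩
    rw [shift_val]
    simp only
    omega

theorem isBounded_shift {N N' : ℕ} {D : PolygonDissection N'} {s : ℕ} (h : N + s ≤ N')
    {a b : Fin N'} (ha : (a : ℕ) = s) (hb : (b : ℕ) + 1 = s + N)
    (hab : IsSide Finset.univ (a, b) ∨ (a, b) ∈ D.diagonals) : D.IsBounded (shift s h) := by
  intro p hp
  rcases (isSide_univ_iff p).mp hp with hp | ⟨h0, h1, h2⟩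
  · left
    rw [isSide_univ_iff]
    left
    rw [shift_val, shift_val, hp]
    omega
  · have e1 : shift s h p.1 = a := Fin.ext (by rw [shift_val]; omega)
    have e2 : shift s h p.2 = b := Fin.ext (by rw [shift_val]; omega)
    rwa [e1, e2]

/-- The part of the dissection between `i` and `j` is again a 3d-dissection, and its quiddity is
positive because it is an `EarList`. Hence every vertex there lies in some sub-polygon on that side.
-/
theorem IsThreeD.exists_subpolygon {N : ℕ} {D : PolygonDissection N} (hD : D.IsThreeD)
    {i j v : Fin N} (hd : (i, j) ∈ D.diagonals) (hi : i ≤ v) (hj : v ≤ j) :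
    ∃ S ∈ D.subpolygons, v ∈ S ∧ ∀ s ∈ S, i ≤ s ∧ s ≤ j := by
  have hij := (isDiagonal_univ_iff _).mp (D.isDiagonal _ hd)
  simp only at hij
  obtain ⟨M, hM⟩ : ∃ M : ℕ, (j : ℕ) + 1 = i + M := ⟨j + 1 - i, by omega⟩
  have hMN : M + i ≤ N := by omega
  have hφ := isBounded_shift hMN rfl hM (Or.inr hd)
  have hR := (hφ.isThreeD_restrict fun S hS _ => hD S hS).earList (by omega)
  obtain ⟨t, ht⟩ := (mem_range_shift (h := hMN) (v := v)).mpr ⟨hi, by omega⟩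
  have hpos := hR.pos ((D.restrict (shift i hMN)).quiddity t) (by simp)
  rw [hφ.quiddity_restrict, Nat.cast_pos, Finset.card_pos] at hpos
  obtain ⟨S, hS⟩ := hpos
  rw [Finset.mem_filter, ht] at hS
  refine ⟨S, hS.1, hS.2.1, fun s hs => ?_⟩
  have := mem_range_shift.mp (hS.2.2 s hs)
  simp only [Fin.le_def]
  omega

/-! ### Capped dissections -/

section capped

/-- The sub-polygon of weight `-1` of a capped dissection. -/
def capU (n : ℕ) : Finset (Fin (n + 2)) := {0, 1, Fin.last (n + 1)}

/-- The neighbour of `capU`. -/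
def capV (n : ℕ) : Finset (Fin (n + 2)) := {1, ⟨n, by omega⟩, Fin.last (n + 1)}

variable {n : ℕ} (hn : 3 ≤ n) {D : PolygonDissection (n + 2)}

include hn in
theorem sum_weights_eq (hU : D.IsSubpolygon (capU n)) (hV : D.IsSubpolygon (capV n))
    (hS : ∀ S ∈ D.subpolygons, (∀ s ∈ S, s ∈ Set.range (shift (N' := n + 2) 1 (Nat.le_succ (n + 1)))) ∨
      S = capU n ∨ S = capV n)
    (hφ : D.IsBounded (shift (N' := n + 2) 1 (Nat.le_succ (n + 1)))) (i : Fin n) :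
    ∑ S ∈ D.subpolygons.filter fun S => i.succ.castSucc ∈ S, (if S = capU n then (-1 : ℤ) else 1) =
      (D.restrict (shift 1 (Nat.le_succ (n + 1)))).quiddity i + if (i : ℕ) + 1 = n then 1 else 0 := by
  classical
  have hi : i.succ.castSucc = shift (N' := n + 2) 1 (Nat.le_succ (n + 1)) i := rfl
  have hi' := i.2
  have hrU : ¬ ∀ s ∈ capU n, s ∈ Set.range (shift (N' := n + 2) 1 (Nat.le_succ (n + 1))) := by
    intro h
    have := mem_range_shift.mp (h 0 (by simp [capU]))
    simp at this
  have hrV : ¬ ∀ s ∈ capV n, s ∈ Set.range (shift (N' := n + 2) 1 (Nat.le_succ (n + 1))) := by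
    intro h
    have := mem_range_shift.mp (h (Fin.last (n + 1)) (by simp [capV]))
    simp only [Fin.val_last] at this
    omega
  have hUV : capU n ≠ capV n := by
    intro h
    have : (0 : Fin (n + 2)) ∈ capV n := h ▸ (by simp [capU])
    simp only [capV, Finset.mem_insert, Finset.mem_singleton, Fin.ext_iff, Fin.val_zero,
      Fin.val_one, Fin.val_last] at this
    omega
  have hsplit : (D.subpolygons.filter fun S => i.succ.castSucc ∈ S) =
      (D.subpolygons.filter fun S => i.succ.castSucc ∈ S ∧
        ∀ s ∈ S, s ∈ Set.range (shift (N' := n + 2) 1 (Nat.le_succ (n + 1)))) ∪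
      ({capU n, capV n} : Finset _).filter fun S => i.succ.castSucc ∈ S := by
    ext S
    simp only [Finset.mem_filter, Finset.mem_union, Finset.mem_insert, Finset.mem_singleton]
    constructor
    · rintro ⟨h1, h2⟩
      rcases hS S h1 with h | h
      · exact Or.inl ⟨h1, h2, h⟩
      · exact Or.inr ⟨h, h2⟩
    · rintro (⟨h1, h2, -⟩ | ⟨rfl | rfl, h2⟩)
      · exact ⟨h1, h2⟩
      · exact ⟨mem_subpolygons.mpr hU, h2⟩
      · exact ⟨mem_subpolygons.mpr hV, h2⟩
  rw [hsplit, Finset.sum_union, hφ.quiddity_restrict, ← hi]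
  · congr 1
    · rw [Finset.sum_congr rfl (g := fun _ => (1 : ℤ))]
      · simp
      · intro S hS
        rw [if_neg]
        rintro rfl
        exact hrU (Finset.mem_filter.mp hS).2.2
    · rw [Finset.sum_filter, Finset.sum_pair hUV, if_pos rfl, if_neg hUV.symm]
      -- The index `i` stands for vertex `i + 1`. At vertex 1 the weights of `capU` and `capV`
      -- cancel, and at vertex `n` only `capV` contributes.
      have h1 : i.succ.castSucc ∈ capU n ↔ (i : ℕ) = 0 := by
        simp only [capU, Finset.mem_insert, Finset.mem_singleton, Fin.ext_iff, Fin.val_zero,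
          Fin.val_one, Fin.val_last, Fin.val_castSucc, Fin.val_succ]
        omega
      have h2 : i.succ.castSucc ∈ capV n ↔ (i : ℕ) = 0 ∨ (i : ℕ) + 1 = n := by
        simp only [capV, Finset.mem_insert, Finset.mem_singleton, Fin.ext_iff,
          Fin.val_one, Fin.val_last, Fin.val_castSucc, Fin.val_succ]
        omega
      simp only [h1, h2]
      split_ifs <;> first | rfl | (exfalso; omega)
  · rw [Finset.disjoint_left]
    intro S h1 h2
    simp only [Finset.mem_filter, Finset.mem_insert, Finset.mem_singleton] at h1 h2
    rcases h2.1 with rfl | rfl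
    · exact hrU h1.2.2
    · exact hrV h1.2.2

-- If a side of `U` at vertex 0 or of `V` at vertex -1 that should be a side of `P` were a diagonal,
-- a sub-polygon beyond it would also contain that vertex. This contradicts the list of sub-polygons
-- allowed there.
include hn in
theorem IsCapped.eq_cap {U V : Finset (Fin (n + 2))} (h : D.IsCapped U V) :
    U = capU n ∧ V = capV n := by
  obtain ⟨h3, ⟨hU, hU3, -⟩, ⟨hV, hVU, hV3, ⟨p, hpU, hpV⟩, -⟩, h0, hl⟩ := h
  have h0U := (h0 U hU).mpr rfl
  have hlU := (hl U hU).mpr (Or.inl rfl)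
  have hlV := (hl V hV).mpr (Or.inr rfl)
  have h0V : 0 ∉ V := fun h => hVU ((h0 V hV).mp h)
  obtain ⟨c, hc0, hcl, rfl⟩ := eq_triple_of_card hU3 h0U hlU (by simp [Fin.ext_iff])
  rw [Ne, Fin.ext_iff] at hc0 hcl
  simp only [Fin.val_zero, Fin.val_last] at hc0 hcl
  have hc2 := c.2
  have h0c : 0 < c := Fin.lt_def.mpr (by simp only [Fin.val_zero]; omega)
  have hcl' : c < Fin.last (n + 1) := Fin.lt_def.mpr (by simp only [Fin.val_last]; omega)
  have hc : c = 1 := by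
    rcases (mem_subpolygons.mp hU).2.1 (0, c)
      ((isSide_triple_iff h0c hcl' _).mpr (Or.inl rfl)) with h | h
    · rw [isSide_univ_iff] at h
      simp only [Fin.val_zero] at h
      rw [Fin.ext_iff, Fin.val_one]
      omega
    · exfalso
      obtain ⟨S, hS, hS0, hSc⟩ := IsThreeD.exists_subpolygon h3 h le_rfl h0c.le
      obtain rfl := (h0 S hS).mp hS0
      exact absurd (hSc _ hlU).2 (not_le.mpr hcl')
  subst hc
  refine ⟨rfl, ?_⟩
  -- The common side of `U` and `V` avoids vertex 0, hence joins 1 to the last vertex.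
  have h1V : 1 ∈ V := by
    rcases (isSide_triple_iff h0c hcl' _).mp hpU with rfl | rfl | rfl
    · exact absurd hpV.1 h0V
    · exact hpV.1
    · exact absurd hpV.1 h0V
  obtain ⟨x, hx1, hxl, rfl⟩ := eq_triple_of_card hV3 h1V hlV hcl'.ne
  have hx0 : x ≠ 0 := by
    rintro rfl
    exact h0V (by simp)
  rw [Ne, Fin.ext_iff] at hx1 hxl hx0
  simp only [Fin.val_zero, Fin.val_last, Fin.val_one] at hx1 hxl hx0
  have hx2 := x.2
  have h1x : 1 < x := Fin.lt_def.mpr (by simp only [Fin.val_one]; omega)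
  have hxl' : x < Fin.last (n + 1) := Fin.lt_def.mpr (by simp only [Fin.val_last]; omega)
  have hx : (x : ℕ) = n := by
    rcases (mem_subpolygons.mp hV).2.1 (x, Fin.last (n + 1))
      ((isSide_triple_iff h1x hxl' _).mpr (Or.inr (Or.inl rfl))) with h | h
    · rw [isSide_univ_iff] at h
      simp only [Fin.val_last] at h
      omega
    · exfalso
      obtain ⟨S, hS, hSl, hSx⟩ := IsThreeD.exists_subpolygon h3 h hxl'.le le_rfl
      have h1S : 1 ∈ S := by
        rcases (hl S hS).mp hSl with rfl | rfl <;> simp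
      exact absurd (hSx _ h1S).1 (not_le.mpr h1x)
  exact congrArg (fun y => ({1, y, Fin.last (n + 1)} : Finset (Fin (n + 2))))
    (Fin.ext hx : x = ⟨n, by omega⟩)

include hn in
theorem isCappedQuiddity_iff (a : Fin n → ℤ) : IsCappedQuiddity a ↔
    ∃ D : PolygonDissection n, D.IsThreeD ∧
      ∀ i : Fin n, a i = D.quiddity i + if (i : ℕ) + 1 = n then 1 else 0 := by
  have h01 : (0 : Fin (n + 2)) < 1 := by simp
  have h1n : (1 : Fin (n + 2)) < ⟨n, by omega⟩ := by
    simp only [Fin.lt_def, Fin.val_one]; omega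
  have hnl : (⟨n, by omega⟩ : Fin (n + 2)) < Fin.last (n + 1) := by
    simp [Fin.lt_def]
  have h1l := h1n.trans hnl
  constructor
  · rintro ⟨D, U, V, h, ha⟩
    obtain ⟨rfl, rfl⟩ := h.eq_cap hn
    obtain ⟨h3, ⟨hU, -⟩, ⟨hV, -⟩, h0, hl⟩ := h
    rw [mem_subpolygons] at hU hV
    have hφ : D.IsBounded (shift (N' := n + 2) 1 (Nat.le_succ (n + 1))) :=
      isBounded_shift _ (a := 1) (b := ⟨n, by omega⟩) (by simp) (by simp only; omega)
        (hV.2.1 _ ((isSide_triple_iff h1n hnl _).mpr (Or.inl rfl)))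
    refine ⟨D.restrict (shift 1 (Nat.le_succ (n + 1))),
      hφ.isThreeD_restrict fun S hS _ => h3 S hS, fun i => ?_⟩
    rw [ha, sum_weights_eq hn hU hV ?_ hφ]
    intro S hS
    by_cases hr : ∀ s ∈ S, s ∈ Set.range (shift (N' := n + 2) 1 (Nat.le_succ (n + 1)))
    · exact Or.inl hr
    · right
      push Not at hr
      obtain ⟨s, hs, hsr⟩ := hr
      rw [mem_range_shift] at hsr
      have hs2 := s.2
      rcases (show (s : ℕ) = 0 ∨ (s : ℕ) = n + 1 by omega) with h | h
      · obtain rfl : s = 0 := Fin.ext h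
        exact Or.inl ((h0 S hS).mp hs)
      · obtain rfl : s = Fin.last (n + 1) := Fin.ext h
        exact (hl S hS).mp hs
  · rintro ⟨D, hD, ha⟩
    have hmem : ∀ e : Fin (n + 2) × Fin (n + 2),
        e ∈ ({(1, ⟨n, by omega⟩), (1, Fin.last (n + 1))} : Finset _) ↔
          (e.1 : ℕ) = 1 ∧ ((e.2 : ℕ) = n ∨ (e.2 : ℕ) = n + 1) := by
      rintro ⟨u, v⟩
      simp only [Finset.mem_insert, Finset.mem_singleton, Prod.mk.injEq, Fin.ext_iff,
        Fin.val_one, Fin.val_last]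
      omega
    let D' := D.extend (shift (N' := n + 2) 1 (Nat.le_succ (n + 1)))
      {(1, ⟨n, by omega⟩), (1, Fin.last (n + 1))}
      (by
        intro e he
        rw [hmem] at he
        rw [isDiagonal_univ_iff]
        omega)
      (by
        intro e he e' he'
        rw [hmem] at he he'
        simp only [Crosses, Fin.lt_def]
        omega)
      (by
        intro e he p
        rw [hmem] at he
        simp only [Crosses, Fin.lt_def, shift_val]
        omega)
    have hR : D'.restrict (shift (N' := n + 2) 1 (Nat.le_succ (n + 1))) = D := by
      refine restrict_extend fun p hp hpd => ?_
      exfalso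
      rw [hmem] at hpd
      rw [isDiagonal_univ_iff] at hp
      simp only [shift_val] at hpd
      omega
    have hd1 : (1, ⟨n, by omega⟩) ∈ D'.diagonals := mem_extend_diagonals.mpr (Or.inr (by simp))
    have hd2 : (1, Fin.last (n + 1)) ∈ D'.diagonals :=
      mem_extend_diagonals.mpr (Or.inr (by simp))
    have hs1 : IsSide Finset.univ ((0 : Fin (n + 2)), (1 : Fin (n + 2))) := by
      rw [isSide_univ_iff]; simp
    have hs2 : IsSide Finset.univ ((0 : Fin (n + 2)), Fin.last (n + 1)) := by
      rw [isSide_univ_iff]; right; simp [Fin.lt_def]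
    have hs3 : IsSide Finset.univ ((⟨n, by omega⟩ : Fin (n + 2)), Fin.last (n + 1)) := by
      rw [isSide_univ_iff]; simp
    have hU : D'.IsSubpolygon (capU n) :=
      isSubpolygon_triple h01 h1l (Or.inl hs1) (Or.inr hd2) (Or.inl hs2)
    have hV : D'.IsSubpolygon (capV n) :=
      isSubpolygon_triple h1n hnl (Or.inr hd1) (Or.inl hs3) (Or.inr hd2)
    have hφ : D'.IsBounded (shift (N' := n + 2) 1 (Nat.le_succ (n + 1))) :=
      isBounded_shift _ (a := 1) (b := ⟨n, by omega⟩) (by simp) (by simp only; omega) (Or.inr hd1)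
    have hS : ∀ S ∈ D'.subpolygons,
        (∀ s ∈ S, s ∈ Set.range (shift (N' := n + 2) 1 (Nat.le_succ (n + 1)))) ∨
          S = capU n ∨ S = capV n := by
      intro S hS
      rw [mem_subpolygons] at hS
      -- The two new diagonals cut the polygon into three regions: the cap `capU`, its neighbour
      -- `capV`, and the embedded polygon.
      rcases hS.one_side hd2 with h | h
      · rcases hS.one_side hd1 with h' | h'
        · left
          intro s hs
          have := h' s hs
          simp only [Fin.le_def, Fin.val_one] at this
          rw [mem_range_shift]
          omega
        · right; right
          refine hS.eq_of_subset hV fun s hs => ?_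
          have h1 := h s hs
          have h2 := h' s hs
          simp only [Fin.le_def, Fin.val_one, Fin.val_last] at h1 h2
          simp only [capV, Finset.mem_insert, Finset.mem_singleton, Fin.ext_iff, Fin.val_one,
            Fin.val_last]
          omega
      · right; left
        refine hS.eq_of_subset hU fun s hs => ?_
        have h1 := h s hs
        simp only [Fin.le_def, Fin.val_one, Fin.val_last] at h1
        simp only [capU, Finset.mem_insert, Finset.mem_singleton, Fin.ext_iff, Fin.val_one,
          Fin.val_last, Fin.val_zero]
        omega
    have h0V : (0 : Fin (n + 2)) ∉ capV n := by
      simp only [capV, Finset.mem_insert, Finset.mem_singleton, Fin.ext_iff, Fin.val_zero,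
        Fin.val_one, Fin.val_last]
      omega
    have h0U : (0 : Fin (n + 2)) ∈ capU n := by simp [capU]
    have hlU : Fin.last (n + 1) ∈ capU n := by simp [capU]
    have hlV : Fin.last (n + 1) ∈ capV n := by simp [capV]
    have hVU : capV n ≠ capU n := fun h => h0V (h ▸ h0U)
    refine ⟨D', capU n, capV n, ⟨?_, ⟨mem_subpolygons.mpr hU, card_triple h01 h1l, ?_⟩,
      ⟨mem_subpolygons.mpr hV, hVU, card_triple h1n hnl, ?_, ?_⟩, ?_, ?_⟩, fun i => ?_⟩
    · intro S hSD
      rcases hS S hSD with h | rfl | rfl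
      · obtain ⟨S', rfl⟩ := exists_map_eq _ h
        rw [mem_subpolygons, ← hφ.isSubpolygon_restrict, hR] at hSD
        rw [Finset.card_map]
        exact hD S' (mem_subpolygons.mpr hSD)
      · exact (card_triple h01 h1l).symm ▸ dvd_rfl
      · exact (card_triple h1n hnl).symm ▸ dvd_rfl
    · have : outerSides (capU n) = {(0, 1), (0, Fin.last (n + 1))} := by
        ext p
        simp only [outerSides, Finset.mem_filter, Finset.mem_univ, true_and, Finset.mem_insert,
          Finset.mem_singleton]
        rw [capU, isSide_triple_iff h01 h1l]
        constructor
        · rintro ⟨rfl | rfl | rfl, h⟩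
          · exact Or.inl rfl
          · exact absurd h (D'.isDiagonal _ hd2).2.2.2
          · exact Or.inr rfl
        · rintro (rfl | rfl)
          · exact ⟨Or.inl rfl, hs1⟩
          · exact ⟨Or.inr (Or.inr rfl), hs2⟩
      rw [this, Finset.card_pair]
      exact fun h => h1l.ne (congrArg Prod.snd h)
    · exact ⟨(1, Fin.last (n + 1)), (isSide_triple_iff h01 h1l _).mpr (Or.inr (Or.inl rfl)),
        (isSide_triple_iff h1n hnl _).mpr (Or.inr (Or.inr rfl))⟩
    · refine ⟨(⟨n, by omega⟩, Fin.last (n + 1)), ?_⟩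
      simp only [outerSides, Finset.mem_filter, Finset.mem_univ, true_and]
      exact ⟨(isSide_triple_iff h1n hnl _).mpr (Or.inr (Or.inl rfl)), hs3⟩
    · intro S hSD
      refine ⟨fun h => ?_, fun h => h ▸ h0U⟩
      rcases hS S hSD with hr | rfl | rfl
      · have := mem_range_shift.mp (hr 0 h)
        simp at this
      · rfl
      · exact absurd h h0V
    · intro S hSD
      refine ⟨fun h => ?_, by rintro (rfl | rfl) <;> assumption⟩
      rcases hS S hSD with hr | h | h
      · have := mem_range_shift.mp (hr _ h)
        simp only [Fin.val_last] at this
        omega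
      · exact Or.inl h
      · exact Or.inr h
    · rw [sum_weights_eq hn hU hV hS hφ, hR, ha]

end capped

end PolygonDissection


/-! ### Notched dissections. -/

namespace PolygonDissection

section notched

variable {m x y : ℕ} {D : PolygonDissection (m + 1)} {b c : Fin (m + 1)}
  (hx : 1 < x) (hy : 1 < y) (hxy : x + y = m + 1) (hb : (b : ℕ) = 1) (hc : (c : ℕ) = x)
  (hbc : (b, c) ∈ D.diagonals) (hcl : (c, Fin.last m) ∈ D.diagonals)
  (hQ : D.IsSubpolygon {0, b, c, Fin.last m})

include hx hy hxy hb hc hbc hcl hQ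

/-- The diagonals `(b, c)` and `(c, Fin.last m)` cut off the polygons 1, …, c and c, …, m. What is
left has only the four vertices of the quadrilateral. -/
theorem notched_cases {S : Finset (Fin (m + 1))} (hS : D.IsSubpolygon S) :
    S = {0, b, c, Fin.last m} ∨
      (∀ s ∈ S, s ∈ Set.range (shift (N := x) (N' := m + 1) 1 (by omega))) ∨
      ∀ s ∈ S, s ∈ Set.range (shift (N := y) (N' := m + 1) x (by omega)) := by
  rcases hS.one_side hbc with h1 | h1
  · right; left
    intro s hs
    have := h1 s hs
    rw [mem_range_shift]
    simp only [Fin.le_def] at this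
    omega
  · rcases hS.one_side hcl with h2 | h2
    · right; right
      intro s hs
      have := h2 s hs
      rw [mem_range_shift]
      simp only [Fin.le_def, Fin.val_last] at this
      omega
    · left
      refine hS.eq_of_subset hQ fun s hs => ?_
      have h1 := h1 s hs
      have h2 := h2 s hs
      simp only [Fin.le_def, Fin.val_last] at h1 h2
      simp only [Finset.mem_insert, Finset.mem_singleton, Fin.ext_iff, Fin.val_last, Fin.val_zero]
      omega

theorem card_filter_notched
    (h3 : ∀ S ∈ D.subpolygons, S ≠ {0, b, c, Fin.last m} → 3 ∣ S.card) (v : Fin (m + 1)) :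
    (D.subpolygons.filter fun S => 3 ∣ S.card ∧ v ∈ S).card =
      (D.subpolygons.filter fun S => v ∈ S ∧
        ∀ s ∈ S, s ∈ Set.range (shift (N := x) (N' := m + 1) 1 (by omega))).card +
      (D.subpolygons.filter fun S => v ∈ S ∧
        ∀ s ∈ S, s ∈ Set.range (shift (N := y) (N' := m + 1) x (by omega))).card := by
  classical
  have hQ4 : ({0, b, c, Fin.last m} : Finset (Fin (m + 1))).card = 4 := by
    apply card_quadruple <;> simp only [Fin.lt_def, Fin.val_last, Fin.val_zero] <;> omega
  rw [← Finset.card_union_of_disjoint]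
  · congr 1
    ext S
    simp only [Finset.mem_filter, Finset.mem_union]
    constructor
    · rintro ⟨hS, hS3, hv⟩
      rcases notched_cases hx hy hxy hb hc hbc hcl hQ (mem_subpolygons.mp hS) with rfl | h | h
      · omega
      · exact Or.inl ⟨hS, hv, h⟩
      · exact Or.inr ⟨hS, hv, h⟩
    · rintro (⟨hS, hv, h⟩ | ⟨hS, hv, h⟩) <;> refine ⟨hS, h3 S hS ?_, hv⟩ <;> rintro rfl <;>
        have := mem_range_shift.mp (h 0 (by simp)) <;> simp only [Fin.val_zero] at this <;> omega
  · rw [Finset.disjoint_left]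
    intro S h1 h2
    rw [Finset.mem_filter, mem_subpolygons] at h1 h2
    -- The two pieces share only the vertex `c`, so no sub-polygon is counted twice.
    have : S ⊆ {c} := by
      intro s hs
      have h1 := mem_range_shift.mp (h1.2.2 s hs)
      have h2 := mem_range_shift.mp (h2.2.2 s hs)
      rw [Finset.mem_singleton, Fin.ext_iff]
      omega
    have := Finset.card_le_card this
    have := h1.1.1
    simp at *
    omega

/-- The quadrilateral does not count. Reading the vertices 1, …, m lists the two pieces in turn, and
their counts add up at the shared vertex `c`. -/
theorem ofFn_notched {a : Fin m → ℤ}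
    (h3 : ∀ S ∈ D.subpolygons, S ≠ {0, b, c, Fin.last m} → 3 ∣ S.card)
    (ha : ∀ i : Fin m, a i = ((D.subpolygons.filter fun S => 3 ∣ S.card ∧ i.succ ∈ S).card : ℤ))
    {l r : List ℤ} {s t : ℤ}
    (hl : List.ofFn (D.restrict (shift (N := x) 1 (by omega))).quiddity = l ++ [s])
    (hr : List.ofFn (D.restrict (shift (N := y) x (by omega))).quiddity = t :: r) :
    List.ofFn a = l ++ (s + t) :: r := by
  have hφ₁ : D.IsBounded (shift (N := x) 1 (by omega)) :=
    isBounded_shift _ hb (by rw [hc]; omega) (Or.inr hbc)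
  have hφ₂ : D.IsBounded (shift (N := y) x (by omega)) :=
    isBounded_shift _ hc (by rw [Fin.val_last]; omega) (Or.inr hcl)
  have hlx : x = l.length + 1 := by simpa using congrArg List.length hl
  have hry : y = r.length + 1 := by simpa using congrArg List.length hr
  have hq₁ : ∀ (k : ℕ) (hk : k < x), (D.restrict (shift (N := x) 1 (by omega))).quiddity ⟨k, hk⟩ =
      (l ++ [s])[k]'(by simp; omega) := by
    intro k hk
    simp [← hl]
  have hq₂ : ∀ (k : ℕ) (hk : k < y), (D.restrict (shift (N := y) x (by omega))).quiddity ⟨k, hk⟩ =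
      (t :: r)[k]'(by simp; omega) := by
    intro k hk
    simp [← hr]
  refine List.ext_getElem (by simp; omega) fun k hk hk' => ?_
  have hkm : k < m := by simpa using hk
  rw [List.getElem_ofFn, ha, card_filter_notched hx hy hxy hb hc hbc hcl hQ h3, Nat.cast_add]
  have e₁ : ((D.subpolygons.filter fun S => (⟨k, hkm⟩ : Fin m).succ ∈ S ∧
      ∀ s ∈ S, s ∈ Set.range (shift (N := x) (N' := m + 1) 1 (by omega))).card : ℤ) =
      if hk : k < x then (l ++ [s])[k]'(by simp; omega) else 0 := by
    split_ifs with hkx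
    · rw [← hq₁ k hkx, hφ₁.quiddity_restrict]
      rfl
    · rw [Nat.cast_eq_zero, Finset.card_eq_zero, Finset.filter_eq_empty_iff]
      rintro S - ⟨h1, h2⟩
      have := mem_range_shift.mp (h2 _ h1)
      simp only [Fin.val_succ] at this
      omega
  have e₂ : ((D.subpolygons.filter fun S => (⟨k, hkm⟩ : Fin m).succ ∈ S ∧
      ∀ s ∈ S, s ∈ Set.range (shift (N := y) (N' := m + 1) x (by omega))).card : ℤ) =
      if hk : x ≤ k + 1 then (t :: r)[k + 1 - x]'(by simp; omega) else 0 := by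
    split_ifs with hkx
    · rw [← hq₂ (k + 1 - x) (by omega), hφ₂.quiddity_restrict]
      have : shift (N := y) (N' := m + 1) x (by omega) ⟨k + 1 - x, by omega⟩ =
          (⟨k, hkm⟩ : Fin m).succ := Fin.ext (by
        rw [shift_val, Fin.val_succ]
        simp only
        omega)
      rw [this]
    · rw [Nat.cast_eq_zero, Finset.card_eq_zero, Finset.filter_eq_empty_iff]
      rintro S - ⟨h1, h2⟩
      have := mem_range_shift.mp (h2 _ h1)
      simp only [Fin.val_succ] at this
      omega
  rw [e₁, e₂]
  subst hlx
  rcases lt_trichotomy k l.length with h | rfl | h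
  · rw [dif_pos (by omega), dif_neg (by omega), List.getElem_append_left h,
      List.getElem_append_left h, add_zero]
  · rw [dif_pos (by omega), dif_pos (by omega)]
    simp
  · rw [dif_neg (by omega), dif_pos (by omega)]
    obtain ⟨u, rfl⟩ : ∃ u, k = l.length + (u + 1) := ⟨k - l.length - 1, by omega⟩
    rw [List.getElem_append_right (by omega), zero_add]
    simp [show l.length + (u + 1) + 1 - (l.length + 1) = u + 1 by omega]

end notched

theorem IsNotched.exists_eq {m : ℕ} {D : PolygonDissection (m + 1)} (h : D.IsNotched) :
    ∃ b c : Fin (m + 1), (b : ℕ) = 1 ∧ (b, c) ∈ D.diagonals ∧ (c, Fin.last m) ∈ D.diagonals ∧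
      D.IsSubpolygon {0, b, c, Fin.last m} ∧
      ∀ S ∈ D.subpolygons, S ≠ {0, b, c, Fin.last m} → 3 ∣ S.card := by
  obtain ⟨Q, hQ, hQ4, h3, ho, h0⟩ := h
  have hm : 3 ≤ m := by
    have := Finset.card_le_univ Q
    rw [hQ4, Fintype.card_fin] at this
    omega
  obtain ⟨b, hb⟩ : ∃ b : Fin (m + 1), (b : ℕ) = 1 := ⟨⟨1, by omega⟩, rfl⟩
  -- Only two sides of `P` end at vertex 0. As `Q` has two outer sides, both occur, which fixes
  -- three vertices of `Q` and leaves only `c` free.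
  have hsub : outerSides Q ⊆ {(0, b), (0, Fin.last m)} := by
    intro p hp
    have h1 := h0 p hp
    have h2 := (Finset.mem_filter.mp hp).2
    have h3 : (p.1 : ℕ) < p.2 := h2.1.2.2.1
    have h4 := (isSide_univ_iff p).mp h2.2
    simp only [Finset.mem_insert, Finset.mem_singleton, Prod.ext_iff, Fin.ext_iff, Fin.val_zero,
      Fin.val_last] at h1 ⊢
    omega
  have heq := Finset.eq_of_subset_of_card_le hsub (by rw [ho]; exact Finset.card_le_two)
  have hp1 : (0, b) ∈ outerSides Q := by rw [heq]; simp
  have hp2 : (0, Fin.last m) ∈ outerSides Q := by rw [heq]; simp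
  have hs1 := (Finset.mem_filter.mp hp1).2.1
  have hs2 := (Finset.mem_filter.mp hp2).2.1
  have h0b : 0 < b := hs1.2.2.1
  have hbl : b < Fin.last m := by simp only [Fin.lt_def, Fin.val_last]; omega
  obtain ⟨c, hcQ, hc⟩ := Finset.exists_mem_notMem_of_card_lt_card
    (s := {0, b, Fin.last m}) (t := Q) (by rw [hQ4, card_triple h0b hbl]; norm_num)
  simp only [Finset.mem_insert, Finset.mem_singleton, not_or, Fin.ext_iff, Fin.val_zero,
    Fin.val_last] at hc
  have hc' := c.2
  have hbc : b < c := by simp only [Fin.lt_def]; omega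
  have hcl : c < Fin.last m := by simp only [Fin.lt_def, Fin.val_last]; omega
  obtain rfl : {0, b, c, Fin.last m} = Q := by
    refine Finset.eq_of_subset_of_card_le ?_ (by rw [hQ4, card_quadruple h0b hbc hcl])
    intro z hz
    simp only [Finset.mem_insert, Finset.mem_singleton] at hz
    rcases hz with rfl | rfl | rfl | rfl
    exacts [hs1.1, hs1.2.1, hcQ, hs2.2.1]
  have hdiag : ∀ p, IsSide {0, b, c, Fin.last m} p → p.1 ≠ 0 → p ∈ D.diagonals := by
    intro p hp hp0
    refine ((mem_subpolygons.mp hQ).2.1 p hp).resolve_left fun hu => ?_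
    have := h0 p (Finset.mem_filter.mpr ⟨Finset.mem_univ _, hp, hu⟩)
    rcases this with h | h
    · exact hp0 h
    · have := hp.2.2.1
      rw [h] at this
      exact absurd this (Fin.not_lt_zero _)
  exact ⟨b, c, hb,
    hdiag _ ((isSide_quadruple_iff h0b hbc hcl _).mpr (Or.inr (Or.inl rfl))) h0b.ne',
    hdiag _ ((isSide_quadruple_iff h0b hbc hcl _).mpr (Or.inr (Or.inr (Or.inl rfl))))
      (h0b.trans hbc).ne', mem_subpolygons.mp hQ, h3⟩

theorem isNotchedQuiddity_iff {m : ℕ} (a : Fin m → ℤ) :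
    IsNotchedQuiddity a ↔ IsSplit (List.ofFn a) := by
  constructor
  · rintro ⟨D, h, ha⟩
    obtain ⟨b, c, hb, hbc, hcl, hQ, h3⟩ := h.exists_eq
    have h1 := (isDiagonal_univ_iff _).mp (D.isDiagonal _ hbc)
    have h2 := (isDiagonal_univ_iff _).mp (D.isDiagonal _ hcl)
    simp only [hb, Fin.val_last] at h1 h2
    obtain ⟨y, hxy⟩ : ∃ y, (c : ℕ) + y = m + 1 := ⟨m + 1 - c, by omega⟩
    have hφ₁ : D.IsBounded (shift (N := c) 1 (by omega)) :=
      isBounded_shift _ hb (by omega) (Or.inr hbc)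
    have hφ₂ : D.IsBounded (shift (N := y) c (by omega)) :=
      isBounded_shift _ rfl (by rw [Fin.val_last]; omega) (Or.inr hcl)
    have h0 : ∀ (M s : ℕ) (hM : M + s ≤ m + 1), 0 < s → ∀ S ∈ D.subpolygons,
        (∀ v ∈ S, v ∈ Set.range (shift s hM)) → 3 ∣ S.card := by
      intro M s hM hs S hS hr
      refine h3 S hS ?_
      rintro rfl
      have := mem_range_shift.mp (hr 0 (by simp))
      simp only [Fin.val_zero] at this
      omega
    have hE₁ := (hφ₁.isThreeD_restrict (h0 _ _ _ one_pos)).earList (by omega)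
    have hE₂ := (hφ₂.isThreeD_restrict (h0 _ _ _ (by omega))).earList (by omega)
    obtain ⟨l, s, hl⟩ := (List.eq_nil_or_concat _).resolve_left (earList_iff.mp hE₁).1
    obtain ⟨t, r, hr⟩ := List.exists_cons_of_ne_nil (earList_iff.mp hE₂).1
    rw [List.concat_eq_append] at hl
    rw [hl] at hE₁
    rw [hr] at hE₂
    exact ⟨l, r, s, t, hE₁, hE₂,
      ofFn_notched (by omega) (by omega) hxy hb rfl hbc hcl hQ h3 ha hl hr⟩
  · rintro ⟨l, r, s, t, hl, hr, h⟩
    obtain ⟨x, hlx⟩ : ∃ x, (l ++ [s]).length = x := ⟨_, rfl⟩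
    obtain ⟨y, hry⟩ : ∃ y, (t :: r).length = y := ⟨_, rfl⟩
    obtain ⟨hx, D₁, hD₁, hL₁⟩ := exists_of_earList hl hlx
    obtain ⟨hy, D₂, hD₂, hL₂⟩ := exists_of_earList hr hry
    have hxy : x + y = m + 1 := by
      have := congrArg List.length h
      simp at this hlx hry
      omega
    obtain ⟨b, hb⟩ : ∃ b : Fin (m + 1), (b : ℕ) = 1 := ⟨⟨1, by omega⟩, rfl⟩
    obtain ⟨c, hc⟩ : ∃ c : Fin (m + 1), (c : ℕ) = x := ⟨⟨x, by omega⟩, rfl⟩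
    obtain ⟨φ₁, hφ₁⟩ : ∃ φ₁, φ₁ = shift (N := x) (N' := m + 1) 1 (by omega) := ⟨_, rfl⟩
    obtain ⟨φ₂, hφ₂⟩ : ∃ φ₂, φ₂ = shift (N := y) (N' := m + 1) x (by omega) := ⟨_, rfl⟩
    have hv₁ : ∀ k, (φ₁ k : ℕ) = k + 1 := fun k => by rw [hφ₁, shift_val]
    have hv₂ : ∀ k, (φ₂ k : ℕ) = k + x := fun k => by rw [hφ₂, shift_val]
    have hmem : ∀ e : Fin (m + 1) × Fin (m + 1),
        e ∈ D₂.diagonals.image (fun p => (φ₂ p.1, φ₂ p.2)) ∪ {(b, c), (c, Fin.last m)} ↔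
          (∃ q ∈ D₂.diagonals, (φ₂ q.1, φ₂ q.2) = e) ∨ e = (b, c) ∨ e = (c, Fin.last m) := by
      intro e
      simp only [Finset.mem_union, Finset.mem_image, Finset.mem_insert, Finset.mem_singleton]
    -- `D₁` is the dissection being extended. The diagonals of `D₂` enter as extra ones, together
    -- with the two inner sides of the quadrilateral.
    let D := D₁.extend φ₁
      (D₂.diagonals.image (fun p => (φ₂ p.1, φ₂ p.2)) ∪ {(b, c), (c, Fin.last m)})
      (by
        intro e he
        rcases (hmem e).mp he with ⟨q, hq, rfl⟩ | rfl | rfl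
        · exact (D₂.isDiagonal q hq).map φ₂
        · rw [isDiagonal_univ_iff]
          simp only
          omega
        · rw [isDiagonal_univ_iff]
          simp only [Fin.val_last]
          omega)
      (by
        intro e he e' he'
        rcases (hmem e).mp he with ⟨q, hq, rfl⟩ | rfl | rfl <;>
          rcases (hmem e').mp he' with ⟨q', hq', rfl⟩ | rfl | rfl
        · rw [crosses_map]
          exact D₂.noncrossing q hq q' hq'
        all_goals
          simp only [Crosses, Fin.lt_def, hv₂, Fin.val_last]
          omega)
      (by
        intro e he p
        rcases (hmem e).mp he with ⟨q, hq, rfl⟩ | rfl | rfl <;>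
          simp only [Crosses, Fin.lt_def, hv₁, hv₂, Fin.val_last] <;> omega)
    have hR₁ : D.restrict φ₁ = D₁ := by
      refine restrict_extend fun p hp hpd => ?_
      exfalso
      rw [isDiagonal_univ_iff] at hp
      rcases (hmem _).mp hpd with ⟨q, hq, hqp⟩ | hqp | hqp <;>
        have e₁ := congrArg (fun p => (p.1 : ℕ)) hqp <;>
        have e₂ := congrArg (fun p => (p.2 : ℕ)) hqp <;>
        simp only [hv₁, hv₂, Fin.val_last] at e₁ e₂
      · have : (q.1 : ℕ) < q.2 := (D₂.isDiagonal q hq).2.2.1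
        omega
      · omega
      · omega
    -- The roles of the two pieces are not symmetric in `extend`, so the diagonals are compared
    -- directly here.
    have hR₂ : D.restrict φ₂ = D₂ := by
      refine ext_diagonals (Finset.ext fun p => ?_)
      rw [mem_restrict_diagonals, mem_extend_diagonals, hmem]
      constructor
      · rintro ⟨hp, hpd⟩
        rw [isDiagonal_univ_iff] at hp
        rcases hpd with ⟨q, hq, hqp⟩ | ⟨q, hq, hqp⟩ | hqp | hqp
        · exfalso
          have e₁ := congrArg (fun p => (p.1 : ℕ)) hqp
          have e₂ := congrArg (fun p => (p.2 : ℕ)) hqp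
          simp only [hv₁, hv₂] at e₁ e₂
          omega
        · have : q = p := Prod.ext (φ₂.injective (congrArg Prod.fst hqp))
            (φ₂.injective (congrArg Prod.snd hqp))
          exact this ▸ hq
        all_goals
          exfalso
          have e₁ := congrArg (fun p => (p.1 : ℕ)) hqp
          have e₂ := congrArg (fun p => (p.2 : ℕ)) hqp
          simp only [hv₂, Fin.val_last] at e₁ e₂
          omega
      · exact fun hp => ⟨D₂.isDiagonal p hp, Or.inr (Or.inl ⟨p, hp, rfl⟩)⟩
    have hbc : (b, c) ∈ D.diagonals :=
      mem_extend_diagonals.mpr (Or.inr ((hmem _).mpr (Or.inr (Or.inl rfl))))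
    have hcl : (c, Fin.last m) ∈ D.diagonals :=
      mem_extend_diagonals.mpr (Or.inr ((hmem _).mpr (Or.inr (Or.inr rfl))))
    have h0b' : 0 < b := by simp only [Fin.lt_def, Fin.val_zero]; omega
    have hbc' : b < c := (D.isDiagonal _ hbc).2.2.1
    have hcl' : c < Fin.last m := (D.isDiagonal _ hcl).2.2.1
    have hs1 : IsSide Finset.univ (0, b) := by
      rw [isSide_univ_iff]; left; simpa using hb
    have hs2 : IsSide Finset.univ (0, Fin.last m) := by
      rw [isSide_univ_iff]; right; simp [Fin.lt_def]; omega
    have hQ4 := card_quadruple h0b' hbc' hcl'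
    have hQ : D.IsSubpolygon {0, b, c, Fin.last m} := by
      refine ⟨by omega, fun p hp => ?_, fun p hp hpd => ?_⟩
      · rcases (isSide_quadruple_iff h0b' hbc' hcl' p).mp hp with rfl | rfl | rfl | rfl
        exacts [Or.inl hs1, Or.inr hbc, Or.inr hcl, Or.inl hs2]
      · rw [isDiagonal_quadruple_iff h0b' hbc' hcl'] at hpd
        rcases mem_extend_diagonals.mp hp with ⟨q, hq, rfl⟩ | hp
        · simp only [Prod.mk.injEq, Fin.ext_iff, hv₁, Fin.val_zero, Fin.val_last] at hpd
          omega
        · rcases (hmem _).mp hp with ⟨q, hq, rfl⟩ | rfl | rfl <;>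
            simp only [Prod.mk.injEq, Fin.ext_iff, hv₂, Fin.val_zero, Fin.val_last] at hpd <;>
            omega
    have hB₁ : D.IsBounded φ₁ :=
      hφ₁ ▸ isBounded_shift _ hb (by omega) (Or.inr hbc)
    have hB₂ : D.IsBounded φ₂ :=
      hφ₂ ▸ isBounded_shift _ hc (by rw [Fin.val_last]; omega) (Or.inr hcl)
    have h3 : ∀ S ∈ D.subpolygons, S ≠ {0, b, c, Fin.last m} → 3 ∣ S.card := by
      intro S hS hSQ
      rw [mem_subpolygons] at hS
      rcases notched_cases (by omega) (by omega) hxy hb hc hbc hcl hQ hS with h | h | h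
      · exact absurd h hSQ
      · rw [← hφ₁] at h
        obtain ⟨S', rfl⟩ := exists_map_eq _ h
        rw [← hB₁.isSubpolygon_restrict, hR₁] at hS
        rw [Finset.card_map]
        exact hD₁ S' (mem_subpolygons.mpr hS)
      · rw [← hφ₂] at h
        obtain ⟨S', rfl⟩ := exists_map_eq _ h
        rw [← hB₂.isSubpolygon_restrict, hR₂] at hS
        rw [Finset.card_map]
        exact hD₂ S' (mem_subpolygons.mpr hS)
    have ho : outerSides {0, b, c, Fin.last m} = {(0, b), (0, Fin.last m)} := by
      ext p
      simp only [outerSides, Finset.mem_filter, Finset.mem_univ, true_and, Finset.mem_insert,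
        Finset.mem_singleton]
      rw [isSide_quadruple_iff h0b' hbc' hcl']
      constructor
      · rintro ⟨rfl | rfl | rfl | rfl, h⟩
        · exact Or.inl rfl
        · exact absurd h (D.isDiagonal _ hbc).2.2.2
        · exact absurd h (D.isDiagonal _ hcl).2.2.2
        · exact Or.inr rfl
      · rintro (rfl | rfl)
        · exact ⟨Or.inl rfl, hs1⟩
        · exact ⟨Or.inr (Or.inr (Or.inr rfl)), hs2⟩
    refine ⟨D, ⟨_, mem_subpolygons.mpr hQ, hQ4, h3, ?_, ?_⟩, ?_⟩
    · rw [ho, Finset.card_pair]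
      exact fun h => (hbc'.trans hcl').ne (congrArg Prod.snd h)
    · intro p hp
      rw [ho] at hp
      simp only [Finset.mem_insert, Finset.mem_singleton] at hp
      rcases hp with rfl | rfl <;> exact Or.inl rfl
    · have := ofFn_notched (a := fun i : Fin m =>
          ((D.subpolygons.filter fun S => 3 ∣ S.card ∧ i.succ ∈ S).card : ℤ))
        (by omega) (by omega) hxy hb hc hbc hcl hQ h3 (fun _ => rfl) (l := l) (r := r) (s := s)
        (t := t) (by rw [← hφ₁, hR₁, hL₁]) (by rw [← hφ₂, hR₂, hL₂])
      rw [← h] at this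
      exact fun i => (congrFun (List.ofFn_injective this) i).symm

end PolygonDissection

/-! ### The two equivalences -/

theorem modularProd_eq_listProd {n : ℕ} (a : Fin n → ℤ) :
    modularProd a = listProd (List.ofFn a) := by
  unfold modularProd listProd stepMatrix
  rw [List.map_ofFn]
  rfl

theorem eqUpToSign_matT_iff (X : Matrix (Fin 2) (Fin 2) ℤ) :
    EqUpToSign (matT * X) matT ↔ EqUpToSign X 1 := by
  constructor
  · intro h
    have hT : (!![1, -1; 0, 1] : Matrix (Fin 2) (Fin 2) ℤ) * matT = 1 := by
      unfold matT; decide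
    have := h.mul_left !![1, -1; 0, 1]
    rwa [← mul_assoc, hT, one_mul] at this
  · intro h
    simpa using h.mul_left matT

theorem listProd_append_add_one (L : List ℤ) (c : ℤ) :
    listProd (L ++ [c + 1]) = matT * listProd (L ++ [c]) := by
  simp only [listProd_append, listProd_singleton, ← matT_mul_stepMatrix, mul_assoc]

theorem List.ofFn_eq_append_last {n : ℕ} (a : Fin (n + 1) → ℤ) :
    List.ofFn a = List.ofFn (fun i : Fin n => a i.castSucc) ++ [a (Fin.last n)] := by
  rw [List.ofFn_succ', List.concat_eq_append]

/-- For two pieces with product ±1, inserting a zero between `x` and `y` gives `stepMatrix 0 ^ 2 =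
-1` for the whole product up to sign. Conversely, the final zero fuses the two end entries
cyclically into one vertex, and the resulting 3d-dissection is cut at that vertex. -/
theorem isSplit_iff {L : List ℤ} :
    IsSplit L ↔ (∀ x ∈ L, 0 < x) ∧ EqUpToSign (listProd (L ++ [0])) 1 := by
  constructor
  · rintro ⟨l, r, x, y, hl, hr, rfl⟩
    refine ⟨fun z hz => ?_, ?_⟩
    · simp only [List.mem_append, List.mem_cons] at hz
      have hx := hl.pos x (by simp)
      have hy := hr.pos y (by simp)
      rcases hz with hz | rfl | hz
      · exact hl.pos z (by simp [hz])
      · omega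
      · exact hr.pos z (by simp [hz])
    · have h1 := hl.listProd
      have h2 := hr.listProd
      rw [listProd_append, listProd_singleton] at h1
      rw [listProd_cons] at h2
      have h0 : EqUpToSign (stepMatrix 0 * stepMatrix 0) 1 := by
        right; simp only [stepMatrix]; decide
      have h3 := ((h2.mul_left (stepMatrix 0)).mul_right (stepMatrix 0)).mul h1
      rw [mul_one, mul_one] at h3
      refine EqUpToSign.trans (Or.inr ?_) (h3.trans h0)
      have h4 := stepMatrix_mul_zero_mul x y
      simp only [listProd_append, listProd_cons, listProd_nil, one_mul]
      rw [← neg_eq_iff_eq_neg.mpr h4]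
      simp only [mul_assoc, mul_neg, neg_mul]
  · rintro ⟨hpos, h⟩
    rcases L with _ | ⟨u, L⟩
    · exfalso
      revert h
      simp only [List.nil_append, listProd_singleton, stepMatrix, EqUpToSign]
      decide
    · rcases L.eq_nil_or_concat with rfl | ⟨L, v, rfl⟩
      · exfalso
        have hu := hpos u (by simp)
        -- For a single entry `u` the lower left entry of the product is `u`, which is positive.
        rcases h with h | h <;> have h := congrFun (congrFun h 1) 0 <;>
          simp [listProd_cons, listProd_nil, stepMatrix, Matrix.mul_apply] at h
        all_goals omega
      · simp only [List.concat_eq_append] at *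
        have hu := hpos u (by simp)
        have hv := hpos v (by simp)
        have hE : EarList ((u + v) :: L) := by
          refine earList_iff.mpr ⟨by simp, ?_, ?_⟩
          · intro z hz
            rcases List.mem_cons.mp hz with rfl | hz
            · omega
            · exact hpos z (by simp [hz])
          · have h1 : listProd ((u :: (L ++ [v])) ++ [0]) =
                (stepMatrix 0 * stepMatrix v) * (listProd L * stepMatrix u) := by
              simp only [listProd_append, listProd_cons, listProd_nil, one_mul, mul_assoc]
            rw [h1] at h
            refine EqUpToSign.trans (Or.inr ?_) h.one_comm
            have h2 := stepMatrix_mul_zero_mul v u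
            rw [listProd_cons, add_comm u v, ← neg_eq_iff_eq_neg.mpr h2]
            simp only [mul_assoc, mul_neg]
        exact hE.isSplit hu hv

theorem isSolutionT_snoc_one_iff {m : ℕ} (a : Fin m → ℤ) :
    IsSolutionT (Fin.snoc a 1 : Fin (m + 1) → ℤ) ↔ IsSplit (List.ofFn a) := by
  -- The last entry is written `0 + 1` so that a factor `matT` can be extracted, leaving 0.
  have hL : List.ofFn (Fin.snoc a 1 : Fin (m + 1) → ℤ) = List.ofFn a ++ [0 + 1] := by
    rw [List.ofFn_eq_append_last]
    simp
  rw [isSplit_iff, ← eqUpToSign_matT_iff, ← listProd_append_add_one, ← hL,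
    ← modularProd_eq_listProd, IsSolutionT, List.forall_mem_ofFn_iff]
  refine and_congr_left' ?_
  constructor
  · intro h i
    simpa using h i.castSucc
  · intro h i
    refine Fin.lastCases ?_ (fun i => ?_) i
    · simp
    · simpa using h i

/-- The condition that the last entry is at least 2 says exactly that it stays positive after `matT`
is extracted, so `earList_iff` applies. -/
theorem isSolutionT_and_two_le_iff {n : ℕ} (a : Fin (n + 1) → ℤ) :
    (IsSolutionT a ∧ 2 ≤ a (Fin.last n)) ↔
      EarList (List.ofFn fun i : Fin (n + 1) => a i - if (i : ℕ) + 1 = n + 1 then 1 else 0) := by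
  have hL : (List.ofFn fun i : Fin (n + 1) => a i - if (i : ℕ) + 1 = n + 1 then 1 else 0) =
      List.ofFn (fun i : Fin n => a i.castSucc) ++ [a (Fin.last n) - 1] := by
    rw [List.ofFn_eq_append_last]
    congr 2
    · funext i
      rw [if_neg, sub_zero]
      have := i.2
      rw [Fin.val_castSucc]
      omega
    · rw [Fin.val_last, if_pos rfl]
  have hM : (modularProd a = matT ∨ modularProd a = -matT) ↔
      EqUpToSign (listProd (List.ofFn (fun i : Fin n => a i.castSucc) ++ [a (Fin.last n) - 1])) 1 := by
    rw [← eqUpToSign_matT_iff, ← listProd_append_add_one, sub_add_cancel,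
      ← List.ofFn_eq_append_last, ← modularProd_eq_listProd, EqUpToSign]
  rw [hL, earList_iff, ← hM, IsSolutionT]
  simp only [List.mem_append, List.mem_singleton, or_imp, forall_and, forall_eq,
    List.forall_mem_ofFn_iff, Fin.forall_fin_succ']
  constructor
  · rintro ⟨⟨⟨h1, h2⟩, h3⟩, h4⟩
    exact ⟨by simp, ⟨h1, by omega⟩, h3⟩
  · rintro ⟨-, ⟨h1, h2⟩, h3⟩
    exact ⟨⟨⟨h1, by omega⟩, h3⟩, by omega⟩

theorem mainTheorem2 (n : ℕ) (hn : 3 ≤ n) :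
    (∀ a : Fin (n - 1) → ℤ,
      IsSolutionT (Fin.snoc a 1 : Fin (n - 1 + 1) → ℤ) ↔ IsNotchedQuiddity a) ∧
    (∀ a : Fin n → ℤ,
      (IsSolutionT a ∧ 2 ≤ a ⟨n - 1, by omega⟩) ↔ IsCappedQuiddity a) := by
  refine ⟨fun a => (isSolutionT_snoc_one_iff a).trans
    (PolygonDissection.isNotchedQuiddity_iff a).symm, fun a => ?_⟩
  obtain ⟨n, rfl⟩ : ∃ k, n = k + 1 := ⟨n - 1, by omega⟩
  refine (isSolutionT_and_two_le_iff a).trans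
    (Iff.trans ?_ (PolygonDissection.isCappedQuiddity_iff hn a).symm)
  constructor
  · intro h
    obtain ⟨-, D, hD, hL⟩ := PolygonDissection.exists_of_earList h (N := n + 1) (by simp)
    refine ⟨D, hD, fun i => ?_⟩
    rw [congrFun (List.ofFn_injective hL) i, sub_add_cancel]
  · rintro ⟨D, hD, ha⟩
    have := hD.earList hn
    convert this using 2
    funext i
    rw [ha, add_sub_cancel_right]
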